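/- **Model.** There are $n$ parties, one of them the dealer $D$, joined pairwise by private authenticated asynchronous channels. A protocol pair $(S,R)$ prescribes for each party a randomized reactive machine: when the party starts $S$ (the dealer with input a secret $s$ from a finite field $\mathcal F$), when it starts $R$ (possible once it has completed $S$), and whenever it receives a message, it draws from a discrete probability distribution, determined by its local state, a new local state and a finite list of messages to send. A party completes $S$ at some point, and completes $R$ with an output in $\mathcal F$. A computationally unbounded, randomized Byzantine adversary controls a set of faulty parties; it sees the messages sent to them, decides what they send, and also determines when nonfaulty parties start $S$ and $R$ and in which order messages are delivered, all as a function of its view (its coins, its actions, and the messages sent to faulty parties). The scheduling is valid if every message between nonfaulty parties is eventually delivered once its recipient participates. **Definition.** $(S,R)$ is an almost-surely terminating $\delta$-correct $t$-resilient Byzantine AVSS (asynchronous verifiable secret sharing) protocol if for every adversary controlling at most $t$ parties with a valid message scheduling, and every secret $s\in\mathcal F$: 1. *Termination.* (a) If $D$ is nonfaulty and all nonfaulty parties participate in $S$, then almost surely each nonfaulty party eventually completes $S$. (b) If some nonfaulty party completes $S$, then almost surely each nonfaulty party that participates in $S$ eventually completes $S$. (c) If all nonfaulty parties complete $S$ and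 begin $R$, then almost surely they all eventually complete $R$. (No bound on the number of steps is required.) 2. *Correctness.* There is a value $r\in\mathcal F$, determined by the configuration of the system at the time when the first nonfaulty party completes $S$, such that with probability at least $\delta$ the following holds unless no nonfaulty party ever completes $S$: if $D$ is nonfaulty then $r=s$, and every nonfaulty party that completes $R$ outputs $r$. 3. *Secrecy.* If $D$ is nonfaulty, the distribution of the adversary's view before the first call of $R$ is the same for all secrets $s\in\mathcal F$. **Theorem.** Let $\mathcal F$ be a finite field, $\varepsilon>0$, and $2\le n\le 4t$. Then there is no almost-surely terminating $\left(\tfrac12+\varepsilon\right)$-correct $t$-resilient Byzantine AVSS protocol $(S,R)$ for $n$ parties with secrets in $\mathcal F$. -/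

import Mathlib

universe u

namespace AVSS

/-- The code of the nonfaulty parties of a pair `(S, R)` of protocols for `n` parties, with a
designated dealer and secrets in `F`. A party is a randomized reactive machine with private
authenticated channels to all parties (itself included). `S` is the code started by `share`
(only the dealer gets a secret as input), `R` the code started by `reconstruct`; both run on one
local memory, so that `R` can use all that was seen in `S` and a party can go on helping in `S`
after it completed it. Every activation draws from a discrete distribution a new local state and
a finite list of messages to send, each with its recipient. -/
structure Protocol (n : ℕ) (F : Type u) where
  dealer : Fin n
  Msg : Type u
  State : Type u
  share : Fin n → Option F → PMF (State × List (Fin n × Msg))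
  reconstruct : Fin n → State → PMF (State × List (Fin n × Msg))
  /-- `receive j st i m`: party `j` in state `st` receives `m` from party `i`. -/
  receive : Fin n → State → Fin n → Msg → PMF (State × List (Fin n × Msg))
  /-- The party completes `S` when it first enters a state with this flag. -/
  shareDone : State → Bool
  /-- The party completes `R`, with output `v`, when during `R` it first enters a state whose
  value here is `some v`. -/
  output : State → Option F

variable {n : ℕ} {F : Type u}

/-- The record of a nonfaulty party that participates in `S`: its state, whether it has completed
`S`, whether it has begun `R`, and its output in `R`, if it has completed `R`. -/
structure Local (P : Protocol n F) where
  state : P.State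
  shared : Bool
  begun : Bool
  output : Option F

/-- A party that just started `S`. -/
def Local.fresh {P : Protocol n F} (st : P.State) : Local P :=
  ⟨st, P.shareDone st, false, none⟩

/-- The record after a change of state; completion of `S` and the output in `R` are permanent. -/
def Local.advance {P : Protocol n F} (l : Local P) (st : P.State) : Local P :=
  ⟨st, l.shared || P.shareDone st, l.begun,
    l.output.or (if l.begun then P.output st else none)⟩

/-- The state of the nonfaulty parties and of the network. -/
structure World (P : Protocol n F) where
  /-- `none`: the party is faulty or does not (yet) participate in `S`. -/
  loc : Fin n → Option (Local P)
  /-- `sent i j`: the messages that nonfaulty `i` has sent to `j` so far, oldest first. -/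
  sent : Fin n → Fin n → List P.Msg
  /-- `delivered i j`: the positions in `sent i j` of the messages already received by `j`. -/
  delivered : Fin n → Fin n → Finset ℕ

def World.init (P : Protocol n F) : World P := ⟨fun _ => none, fun _ _ => [], fun _ _ => ∅⟩

def World.participates {P : Protocol n F} (w : World P) (i : Fin n) : Prop := ∃ l, w.loc i = some l

def World.completedS {P : Protocol n F} (w : World P) (i : Fin n) : Prop :=
  ∃ l, w.loc i = some l ∧ l.shared = true

def World.begunR {P : Protocol n F} (w : World P) (i : Fin n) : Prop :=
  ∃ l, w.loc i = some l ∧ l.begun = true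

/-- Party `i` has completed `R` with output `v`. -/
def World.outputs {P : Protocol n F} (w : World P) (i : Fin n) (v : F) : Prop :=
  ∃ l, w.loc i = some l ∧ l.output = some v

/-- Party `j` gets the record `l` and sends the messages `out`. -/
def World.activate {P : Protocol n F} (w : World P) (j : Fin n) (l : Local P)
    (out : List (Fin n × P.Msg)) : World P where
  loc := Function.update w.loc j (some l)
  sent := Function.update w.sent j
    fun i => w.sent j i ++ (out.filter fun x => x.1 = i).map Prod.snd
  delivered := w.delivered

/-- One step of an asynchronous execution. The adversary lets nonfaulty `j` start `S`, or start
`R`, delivers the `k`-th message sent by nonfaulty `i` to nonfaulty `j`, or lets a faulty `i`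
send a message that reaches nonfaulty `j` at once. An action that is not possible has no effect. -/
inductive Action (P : Protocol n F) where
  | startS (j : Fin n)
  | startR (j : Fin n)
  | deliver (i j : Fin n) (k : ℕ)
  | inject (i j : Fin n) (m : P.Msg)

def Action.isStartR {P : Protocol n F} : Action P → Bool
  | .startR _ => true
  | _ => false

/-- One entry of the adversary's view: its own coins, its action, and the messages (with sender
and recipient) that were sent to faulty parties in this step. -/
abbrev Entry (P : Protocol n F) (Coin : Type u) : Type u :=
  Coin × Action P × List (Fin n × Fin n × P.Msg)

/-- A computationally unbounded randomized Byzantine adversary together with the message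
scheduling: it controls the parties in `corrupt` and chooses each step of the execution as a
function of its view so far (oldest entry first). It sees neither the local states of nonfaulty
parties nor the messages between them. -/
structure Adversary (P : Protocol n F) where
  corrupt : Finset (Fin n)
  Coin : Type u
  next : List (Entry P Coin) → PMF (Coin × Action P)

namespace Adversary

variable {P : Protocol n F} (adv : Adversary P)

/-- Those of the messages `out` of party `j` that are sent to faulty parties. -/
def leak (j : Fin n) (out : List (Fin n × P.Msg)) : List (Fin n × Fin n × P.Msg) :=
  (out.filter fun x => x.1 ∈ adv.corrupt).map fun x => (j, x.1, x.2)

/-- The effect of an action when the secret of the dealer is `s`: the next world and the messages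
sent to faulty parties. Faulty parties never enter `loc`, so they run no code of the protocol and
nothing is delivered to them; what is sent to them is seen by the adversary at once. -/
noncomputable def effect (s : F) (w : World P) :
    Action P → PMF (World P × List (Fin n × Fin n × P.Msg))
  | .startS j =>
    match w.loc j with
    | some _ => PMF.pure (w, [])
    | none =>
      if j ∈ adv.corrupt then PMF.pure (w, [])
      else (P.share j (if j = P.dealer then some s else none)).map fun x =>
        (w.activate j (Local.fresh x.1) x.2, adv.leak j x.2)
  | .startR j =>
    match w.loc j with
    | none => PMF.pure (w, [])
    | some l =>
      if l.shared = true ∧ l.begun = false then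
        (P.reconstruct j l.state).map fun x =>
          (w.activate j (Local.advance { l with begun := true } x.1) x.2, adv.leak j x.2)
      else PMF.pure (w, [])
  | .deliver i j k =>
    match w.loc j, (w.sent i j)[k]? with
    | some l, some m =>
      if k ∈ w.delivered i j then PMF.pure (w, [])
      else (P.receive j l.state i m).map fun x =>
        ({ w.activate j (l.advance x.1) x.2 with
            delivered := Function.update w.delivered i
              (Function.update (w.delivered i) j (insert k (w.delivered i j))) },
          adv.leak j x.2)
    | _, _ => PMF.pure (w, [])
  | .inject i j m =>
    match w.loc j with
    | none => PMF.pure (w, [])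
    | some l =>
      if i ∈ adv.corrupt then
        (P.receive j l.state i m).map fun x =>
          (w.activate j (l.advance x.1) x.2, adv.leak j x.2)
      else PMF.pure (w, [])

/-- A global configuration: the world and the adversary's view. -/
abbrev Config : Type u := World P × List (Entry P adv.Coin)

/-- The law of the next configuration. -/
noncomputable def step (s : F) (c : adv.Config) : PMF adv.Config :=
  (adv.next c.2).bind fun a =>
    (adv.effect s c.1 a.2).map fun x => (x.1, c.2 ++ [(a.1, a.2, x.2)])

/-- The law of the first `k` steps of the execution when the secret of the dealer is `s`: the
current configuration and the list of the earlier ones, latest first. -/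
noncomputable def run (s : F) : ℕ → PMF (adv.Config × List adv.Config)
  | 0 => PMF.pure ((World.init P, []), [])
  | k + 1 => (run s k).bind fun h => (adv.step s h.1).map fun c => (c, h.1 :: h.2)

/-- The probability that the first `k` steps of the execution satisfy `E`. -/
noncomputable def prob (s : F) (k : ℕ) (E : adv.Config × List adv.Config → Prop) : ENNReal :=
  (adv.run s k).toOuterMeasure {h | E h}

/-- `ω` is a possible infinite execution with secret `s`. -/
def IsExecution (s : F) (ω : ℕ → adv.Config) : Prop :=
  ω 0 = (World.init P, []) ∧ ∀ k, ω (k + 1) ∈ (adv.step s (ω k)).support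

/-- The scheduling is valid: in every possible execution, every message from a nonfaulty party to
a nonfaulty party that participates is eventually delivered. -/
def Fair : Prop :=
  ∀ (s : F) (ω : ℕ → adv.Config), adv.IsExecution s ω → ∀ (i j : Fin n) (τ k : ℕ),
    k < ((ω τ).1.sent i j).length → (ω τ).1.participates j → ∃ τ', k ∈ (ω τ').1.delivered i j

open Classical in
/-- The configuration in which a nonfaulty party has completed `S` for the first time, if any. -/
noncomputable def firstCompletion (h : adv.Config × List adv.Config) : Option adv.Config :=
  (h.2.reverse ++ [h.1]).find? fun c => decide (∃ i ∉ adv.corrupt, c.1.completedS i)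

/-- The adversary's view up to the point where the first party is told to begin `R`. -/
def shareView (c : adv.Config) : List (Entry P adv.Coin) :=
  c.2.takeWhile fun e => !e.2.1.isStartR

end Adversary

open Filter Topology

/-- `P` is an almost-surely terminating, `δ`-correct, `t`-resilient Byzantine AVSS protocol.

In the three termination clauses the premise and the conclusion are events that, once they hold,
hold at all later times, and the conclusion implies the premise; hence the limit in the clause is
the probability that in the infinite execution the premise eventually holds and the conclusion
never does. Likewise the event in `correctness` can only turn from true to false as `k` grows, so
the clause says that it holds forever with probability at least `δ`. -/
structure Protocol.IsAVSS (P : Protocol n F) (t : ℕ) (δ : ℝ) : Prop where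
  /-- If the dealer is nonfaulty and all nonfaulty parties participate in `S`, then almost surely
  all nonfaulty parties complete `S`. -/
  termination_dealer : ∀ adv : Adversary P, adv.corrupt.card ≤ t → adv.Fair →
    P.dealer ∉ adv.corrupt → ∀ s : F,
      Tendsto (fun k => adv.prob s k fun h =>
        (∀ i ∉ adv.corrupt, h.1.1.participates i) ∧ ¬ ∀ i ∉ adv.corrupt, h.1.1.completedS i)
        atTop (𝓝 0)
  /-- If some nonfaulty party completes `S`, then almost surely each nonfaulty party `j` that
  participates in `S` completes it. -/
  termination_all : ∀ adv : Adversary P, adv.corrupt.card ≤ t → adv.Fair →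
    ∀ s : F, ∀ j ∉ adv.corrupt,
      Tendsto (fun k => adv.prob s k fun h =>
        ((∃ i ∉ adv.corrupt, h.1.1.completedS i) ∧ h.1.1.participates j) ∧ ¬ h.1.1.completedS j)
        atTop (𝓝 0)
  /-- If all nonfaulty parties complete `S` and begin `R`, then almost surely they all complete
  `R`. -/
  termination_reconstruct : ∀ adv : Adversary P, adv.corrupt.card ≤ t → adv.Fair →
    ∀ s : F,
      Tendsto (fun k => adv.prob s k fun h =>
        (∀ i ∉ adv.corrupt, h.1.1.completedS i ∧ h.1.1.begunR i) ∧
          ¬ ∀ i ∉ adv.corrupt, ∃ v, h.1.1.outputs i v)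
        atTop (𝓝 0)
  /-- A value `r` is determined once the first nonfaulty party has completed `S`, and with
  probability at least `δ` it is the secret if the dealer is nonfaulty, and every nonfaulty party
  that completes `R` outputs it. -/
  correctness : ∀ adv : Adversary P, adv.corrupt.card ≤ t → adv.Fair →
    ∀ s : F, ∃ r : adv.Config → F, ∀ k,
      ENNReal.ofReal δ ≤ adv.prob s k fun h =>
        ∀ c, adv.firstCompletion h = some c →
          (P.dealer ∉ adv.corrupt → r c = s) ∧
            ∀ i ∉ adv.corrupt, ∀ v, h.1.1.outputs i v → v = r c
  /-- If the dealer is nonfaulty, the law of the adversary's view before the first call of `R` is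
  the same for all secrets. -/
  secrecy : ∀ adv : Adversary P, adv.corrupt.card ≤ t → adv.Fair →
    P.dealer ∉ adv.corrupt → ∀ (s s' : F) (k : ℕ),
      (adv.run s k).map (fun h => adv.shareView h.1) =
        (adv.run s' k).map (fun h => adv.shareView h.1)

end AVSS

/-! Split the parties into sets `A`, `B`, `C`, `D` of at most `t` parties, the dealer in `D`, with
`A` and `C` nonempty. Keep `C` asleep and run the sharing honestly until, except with probability
below `ε / 2`, a party `a` of `A` has completed `S`; it must, since `C` could be faulty. By secrecy
the law of what `B` sees, hence that of the conversation between `A` and `B`, is the same for two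
secrets `s ≠ s'`. So an execution with `s` and one with `s'` can be coupled with equal
conversations. The hybrid world gives `A` its data from the first and `B` its data from the second,
leaves `C` untouched and drops `D`.

The hybrid has three readings. (1) The dealer is honest with secret `s`; `B` is faulty, shares
honestly, then redraws its memory from the executions with `s'` given its conversation with `A`. (2)
The dealer is honest with secret `s'`, and `A` is faulty and does the same with `s`. The two laws
agree because the coupled pair may be drawn in either order (`bind_condLaw_comm`). In both readings
the messages of `D` are merely held back. (3) `D` is faulty and treats `A` as in the first execution
and `B` as in the second. A fixed list of actions achieves this with positive probability
(`exists_acts`), and this suffices: almost sure termination survives conditioning on an event of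
positive probability. So once `a` has completed `S`, all of `A`, `B`, `C` reconstruct almost surely
without `D` (`chain_terminates`).

Hence some `c` in `C` has one and the same law of outputs in (1) and (2), and it finishes except
with probability below `ε`. Correctness makes both `s` and `s'` more likely than `1 / 2`, which is
absurd (`not_isAVSS_of_common_law`).

The technical core is that a faulty set can run its own code in its head and so imitate an honest
execution exactly (`simMove_bind`, `simAdv_loc`); the use of secrecy (`hist_map_sim_eq`) rests on
this too. For `n = 2` there is no room for `A` and `C`; there all parties outside `D` form a small
set, and secrecy applies to them directly (`false_of_two_sets`). -/

namespace AVSS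

open Filter Topology

variable {n : ℕ} {F : Type u} {P : Protocol n F}

/-! ### Honest executions -/

/-- A step of an execution in which no party misbehaves: the scheduler's choice, without reference
to the messages of a particular protocol. -/
inductive Move (n : ℕ) where
  | startS (j : Fin n)
  | startR (j : Fin n)
  | deliver (i j : Fin n) (k : ℕ)

/-- The party activated by a move. -/
def Move.target : Move n → Fin n
  | .startS j => j
  | .startR j => j
  | .deliver _ j _ => j

def Move.toAction : Move n → Action P
  | .startS j => .startS j
  | .startR j => .startR j
  | .deliver i j k => .deliver i j k

/-- The `delivered` table after a move that took effect. -/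
def World.mark (w : World P) : Move n → Fin n → Fin n → Finset ℕ
  | .deliver i j k => Function.update w.delivered i
      (Function.update (w.delivered i) j (insert k (w.delivered i j)))
  | _ => w.delivered

/-- The world after a move that took effect and gave its target the record `l` and the outgoing
messages `out`. -/
def World.fire (w : World P) (m : Move n) (l : Local P) (out : List (Fin n × P.Msg)) : World P :=
  { w.activate m.target l out with delivered := w.mark m }

/-- The reaction of the target of a move, when all parties are honest; `none` if the move is not
possible. -/
noncomputable def World.resp (s : F) (w : World P) :
    Move n → Option (PMF (Local P × List (Fin n × P.Msg)))
  | .startS j =>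
    match w.loc j with
    | some _ => none
    | none => some ((P.share j (if j = P.dealer then some s else none)).map fun x =>
        (Local.fresh x.1, x.2))
  | .startR j =>
    match w.loc j with
    | none => none
    | some l =>
      if l.shared = true ∧ l.begun = false then
        some ((P.reconstruct j l.state).map fun x =>
          (Local.advance { l with begun := true } x.1, x.2))
      else none
  | .deliver i j k =>
    match w.loc j, (w.sent i j)[k]? with
    | some l, some m =>
      if k ∈ w.delivered i j then none
      else some ((P.receive j l.state i m).map fun x => (l.advance x.1, x.2))
    | _, _ => none

/-- The law of the world after a move when all parties are honest. -/
noncomputable def hstep (s : F) (w : World P) (m : Move n) : PMF (World P) :=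
  match w.resp s m with
  | none => PMF.pure w
  | some p => p.map fun x => w.fire m x.1 x.2

theorem effect_toAction (adv : Adversary P) (s : F) (w : World P) (m : Move n)
    (hm : m.target ∉ adv.corrupt) :
    adv.effect s w m.toAction = match w.resp s m with
      | none => PMF.pure (w, [])
      | some p => p.map fun x => (w.fire m x.1 x.2, adv.leak m.target x.2) := by
  rcases m with j | j | ⟨i, j, k⟩
  · simp only [Move.target] at hm
    simp only [Move.toAction, Adversary.effect, World.resp]
    cases h : w.loc j <;> simp [hm, PMF.map_comp]; rfl
  · simp only [Move.toAction, Adversary.effect, World.resp]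
    cases h : w.loc j with
    | none => simp
    | some l => simp only; split_ifs <;> simp [PMF.map_comp]; rfl
  · simp only [Move.toAction, Adversary.effect, World.resp]
    cases h : w.loc j with
    | none => simp
    | some l =>
      cases h' : (w.sent i j)[k]? with
      | none => simp
      | some m => simp only; split_ifs <;> simp [PMF.map_comp]; rfl

theorem effect_toAction_fst (adv : Adversary P) (s : F) (w : World P) (m : Move n)
    (hm : m.target ∉ adv.corrupt) :
    (adv.effect s w m.toAction).map Prod.fst = hstep s w m := by
  rw [effect_toAction adv s w m hm, hstep]
  cases w.resp s m with
  | none => simp [PMF.pure_map]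
  | some p => simp [PMF.map_comp]; rfl

theorem effect_toAction_of_corrupt (adv : Adversary P) (s : F) (w : World P) (m : Move n)
    (hm : m.target ∈ adv.corrupt) (hw : w.loc m.target = none) :
    adv.effect s w m.toAction = PMF.pure (w, []) := by
  rcases m with j | j | ⟨i, j, k⟩ <;> simp only [Move.target] at hm hw <;>
    simp [Move.toAction, Adversary.effect, hm, hw]

theorem effect_inject (adv : Adversary P) (s : F) (w : World P) {i j : Fin n} (m : P.Msg)
    {l : Local P} (hi : i ∈ adv.corrupt) (hl : w.loc j = some l) :
    adv.effect s w (.inject i j m) = (P.receive j l.state i m).map fun x =>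
          (w.activate j (l.advance x.1) x.2, adv.leak j x.2) := by
  simp [Adversary.effect, hi, hl]

/-- A reaction reads only the record of the target, the channel of the delivery and, at the dealer
alone, the secret. This locality is what allows worlds and secrets to be exchanged out of sight of
the target. -/
theorem World.resp_congr {s s' : F} {w w' : World P} {m : Move n}
    (hl : w.loc m.target = w'.loc m.target)
    (hd : ∀ i j k, m = .deliver i j k → w.sent i j = w'.sent i j ∧ w.delivered i j = w'.delivered i j)
    (hs : m.target = P.dealer → s = s') : w.resp s m = w'.resp s' m := by
  rcases m with j | j | ⟨i, j, k⟩
  · simp only [Move.target] at hl hs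
    simp only [World.resp, hl]
    by_cases h : j = P.dealer
    · rw [hs h]
    · simp [h]
  · simp only [Move.target] at hl
    simp only [World.resp, hl]
  · simp only [Move.target] at hl
    obtain ⟨h1, h2⟩ := hd i j k rfl
    simp only [World.resp, hl, h1, h2]

theorem mem_support_hstep {s : F} {w w' : World P} {m : Move n} :
    w' ∈ (hstep s w m).support ↔ (w.resp s m = none ∧ w' = w) ∨
      ∃ p, w.resp s m = some p ∧ ∃ x ∈ p.support, w' = w.fire m x.1 x.2 := by
  unfold hstep
  cases w.resp s m with
  | none => simp
  | some p => simp [PMF.support_map, eq_comm]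

/-! ### Imitation of honest parties by a faulty set -/

/-- The part of `u` that is outside the control of the set `X`. -/
def World.mask (X : Finset (Fin n)) (u : World P) : World P where
  loc j := if j ∈ X then none else u.loc j
  sent i j := if i ∈ X then [] else u.sent i j
  delivered i j := if i ∈ X ∨ j ∈ X then ∅ else u.delivered i j

/-- What an adversary remembers that runs the code of the parties under its control. -/
@[ext]
structure Sim (P : Protocol n F) where
  world : World P
  part : Fin n → Prop

/-- The part of `u` that is known to the set `X`. -/
def World.sim (X : Finset (Fin n)) (u : World P) : Sim P where
  world :=
    { loc := fun j => if j ∈ X then u.loc j else none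
      sent := fun i j => if i ∈ X ∨ j ∈ X then u.sent i j else []
      delivered := fun i j => if i ∈ X ∨ j ∈ X then u.delivered i j else ∅ }
  part := u.participates

/-- Note the messages in `lk`. -/
def Sim.absorb (v : Sim P) (lk : List (Fin n × Fin n × P.Msg)) : Sim P where
  world :=
    { v.world with
      sent := fun i j => v.world.sent i j ++
        (lk.filter fun x => x.1 = i ∧ x.2.1 = j).map fun x => x.2.2 }
  part := v.part

/-- Note that a party was told to start. -/
def Sim.note (v : Sim P) (m : Move n) : Fin n → Prop := fun j => v.part j ∨ m = .startS j

open Classical in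
/-- How the adversary who controls `X` imitates a move of an honest execution. -/
noncomputable def simMove (X : Finset (Fin n)) (s : F) (m : Move n) (v : Sim P) :
    PMF (Sim P × Action P) :=
  -- The action sent to the real world is void here, as its target is faulty; only the simulated
  -- world moves.
  if m.target ∈ X then (hstep s v.world m).map fun w => (⟨w, v.note m⟩, m.toAction)
  else match m with
    | .deliver i j k =>
      -- The adversary must know who participates: a message injected at a party that has not
      -- started is lost, whereas an honest one would stay pending and must not be marked as
      -- delivered.
      if i ∈ X ∧ v.part j ∧ k ∉ v.world.delivered i j then
        match (v.world.sent i j)[k]? with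
        | some x => PMF.pure (⟨{ v.world with delivered := v.world.mark m }, v.part⟩, .inject i j x)
        | none => PMF.pure (v, m.toAction)
      else PMF.pure (v, m.toAction)
    | m => PMF.pure (⟨v.world, v.note m⟩, m.toAction)

theorem absorb_nil (v : Sim P) : v.absorb [] = v := by
  simp [Sim.absorb]

theorem filter_leak (adv : Adversary P) (i j a : Fin n) (out : List (Fin n × P.Msg)) :
    ((adv.leak a out).filter fun x => x.1 = i ∧ x.2.1 = j).map (fun x => x.2.2) =
      if i = a ∧ j ∈ adv.corrupt then (out.filter fun x => x.1 = j).map Prod.snd else [] := by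
  induction out with
  | nil => simp [Adversary.leak]
  | cons x out ih =>
    have hc : adv.leak a (x :: out) =
        if x.1 ∈ adv.corrupt then (a, x.1, x.2) :: adv.leak a out else adv.leak a out := by
      unfold Adversary.leak
      split_ifs with h <;> simp [h]
    rw [hc]
    by_cases h1 : x.1 ∈ adv.corrupt
    · rw [if_pos h1, List.filter_cons, List.filter_cons]
      by_cases h2 : i = a
      · by_cases h3 : x.1 = j
        · subst h2 h3
          simpa [h1] using ih
        · simpa [h2, h3] using ih
      · have h2' : a ≠ i := fun h => h2 h.symm
        simpa [h2, h2'] using ih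
    · rw [if_neg h1, ih, List.filter_cons]
      by_cases h3 : x.1 = j
      · subst h3; simp [h1]
      · simp [h3]

theorem World.mark_deliver (w : World P) (i j a b : Fin n) (k : ℕ) :
    w.mark (.deliver i j k) a b =
      if a = i ∧ b = j then insert k (w.delivered i j) else w.delivered a b := by
  unfold World.mark
  by_cases h : a = i
  · subst h
    by_cases h' : b = j
    · subst h'; simp
    · simp [h']
  · simp [h]

theorem World.mark_of_ne_target (w : World P) (m : Move n) (i : Fin n) {j : Fin n} (h : j ≠ m.target) :
    w.mark m i j = w.delivered i j := by
  rcases m with a | a | ⟨a, b, k⟩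
  · rfl
  · rfl
  · simp only [Move.target] at h
    simp [World.mark_deliver, h]

theorem World.ext' {w w' : World P} (h1 : ∀ j, w.loc j = w'.loc j)
    (h2 : ∀ i j, w.sent i j = w'.sent i j) (h3 : ∀ i j, w.delivered i j = w'.delivered i j) :
    w = w' := by
  cases w; cases w'
  simp only [World.mk.injEq]
  exact ⟨funext h1, funext fun i => funext (h2 i), funext fun i => funext (h3 i)⟩

theorem World.fire_loc (w : World P) (m : Move n) (l : Local P) (out : List (Fin n × P.Msg))
    (j : Fin n) : (w.fire m l out).loc j = if j = m.target then some l else w.loc j := by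
  simp [World.fire, World.activate, Function.update_apply]

theorem World.fire_sent (w : World P) (m : Move n) (l : Local P) (out : List (Fin n × P.Msg))
    (i j : Fin n) : (w.fire m l out).sent i j =
      w.sent i j ++ if i = m.target then (out.filter fun x => x.1 = j).map Prod.snd else [] := by
  by_cases h : i = m.target
  · subst h; simp [World.fire, World.activate]
  · simp [World.fire, World.activate, h]

theorem World.fire_delivered (w : World P) (m : Move n) (l : Local P)
    (out : List (Fin n × P.Msg)) : (w.fire m l out).delivered = w.mark m := rfl

theorem World.participates_iff (w : World P) (j : Fin n) : w.participates j ↔ w.loc j ≠ none := by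
  simp [World.participates, Option.ne_none_iff_exists']

theorem World.mask_fire_of_mem {X : Finset (Fin n)} (u : World P) {m : Move n} (hm : m.target ∈ X)
    (l : Local P) (out : List (Fin n × P.Msg)) : (u.fire m l out).mask X = u.mask X := by
  refine World.ext' (fun j => ?_) (fun i j => ?_) (fun i j => ?_)
  · simp only [World.mask, World.fire_loc]
    split_ifs with h1 h2 <;> simp_all
  · simp only [World.mask, World.fire_sent]
    split_ifs with h1 h2 <;> simp_all
  · simp only [World.mask, World.fire_delivered]
    split_ifs with h1
    · rfl
    · rw [World.mark_of_ne_target]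
      rintro rfl
      exact h1 (.inr hm)

theorem World.sim_fire_part (X : Finset (Fin n)) (u : World P) (m : Move n)
    (hr : m ≠ .startS m.target → u.loc m.target ≠ none)
    (l : Local P) (out : List (Fin n × P.Msg)) :
    ((u.fire m l out).sim X).part = (u.sim X).note m := by
  funext j
  apply propext
  simp only [World.sim, Sim.note, World.participates_iff, World.fire_loc]
  by_cases h : j = m.target
  · subst h
    simp only [if_true, ne_eq, reduceCtorEq, not_false_eq_true, true_iff]
    by_cases h' : m = .startS m.target
    · exact .inr h'
    · exact .inl (hr h')
  · rw [if_neg h]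
    refine ⟨.inl, fun h' => h'.resolve_right ?_⟩
    rintro rfl
    exact h rfl

theorem World.loc_ne_none_of_resp {s : F} {u : World P} {m : Move n}
    {p : PMF (Local P × List (Fin n × P.Msg))} (h : u.resp s m = some p)
    (hj : m ≠ .startS m.target) : u.loc m.target ≠ none := by
  rcases m with a | a | ⟨i, a, k⟩
  · exact absurd rfl hj
  · intro h0
    simp only [Move.target] at h0
    simp [World.resp, h0] at h
  · intro h0
    simp only [Move.target] at h0
    simp [World.resp, h0] at h

theorem World.loc_ne_none_of_resp_none {s : F} {u : World P} {j : Fin n}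
    (h : u.resp s (.startS j) = none) : u.loc j ≠ none := by
  intro h0
  simp [World.resp, h0] at h

theorem World.note_sim_of_resp_none {s : F} {X : Finset (Fin n)} {u : World P} {m : Move n}
    (h : u.resp s m = none) : (u.sim X).note m = (u.sim X).part := by
  funext j
  apply propext
  simp only [Sim.note, or_iff_left_iff_imp]
  rintro rfl
  exact (World.participates_iff u j).2 (World.loc_ne_none_of_resp_none h)

theorem World.sim_fire_of_mem {X : Finset (Fin n)} (u : World P) {m : Move n} (hm : m.target ∈ X)
    (hr : m ≠ .startS m.target → u.loc m.target ≠ none)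
    (l : Local P) (out : List (Fin n × P.Msg)) :
    (u.fire m l out).sim X = ⟨(u.sim X).world.fire m l out, (u.sim X).note m⟩ := by
  refine Sim.ext (World.ext' (fun j => ?_) (fun i j => ?_) (fun i j => ?_))
    (World.sim_fire_part X u m hr l out)
  · simp only [World.sim, World.fire_loc]
    split_ifs with h1 h2 <;> simp_all
  · simp only [World.sim, World.fire_sent]
    split_ifs with h1 h2 <;> simp_all
  · simp only [World.fire_delivered]
    rcases m with a | a | ⟨a, b, k⟩
    · simp [World.sim, World.fire, World.mark]
    · simp [World.sim, World.fire, World.mark]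
    · simp only [Move.target] at hm
      simp only [World.sim, World.fire, World.mark_deliver]
      split_ifs with h1 h2 <;> simp_all

/-- The move does not bring a message from `X`. -/
def Move.NotFrom (X : Finset (Fin n)) (m : Move n) : Prop := ∀ i j k, m = .deliver i j k → i ∉ X

theorem World.mask_fire_of_notMem {X : Finset (Fin n)} (u : World P) {m : Move n}
    (hm : m.target ∉ X) (hX : m.NotFrom X) (l : Local P) (out : List (Fin n × P.Msg)) :
    (u.fire m l out).mask X = (u.mask X).fire m l out := by
  refine World.ext' (fun j => ?_) (fun i j => ?_) (fun i j => ?_)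
  · simp only [World.mask, World.fire_loc]
    split_ifs with h1 h2 <;> simp_all
  · simp only [World.mask, World.fire_sent]
    split_ifs with h1 h2 <;> simp_all
  · simp only [World.fire_delivered]
    rcases m with a | a | ⟨a, b, k⟩
    · simp [World.mask, World.fire, World.mark]
    · simp [World.mask, World.fire, World.mark]
    · simp only [Move.target] at hm
      have := hX a b k rfl
      simp only [World.mask, World.fire, World.mark_deliver]
      split_ifs with h1 h2 <;> simp_all

theorem World.sim_fire_of_notMem (adv : Adversary P) (u : World P) {m : Move n}
    (hm : m.target ∉ adv.corrupt) (hX : m.NotFrom adv.corrupt)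
    (hr : m ≠ .startS m.target → u.loc m.target ≠ none)
    (l : Local P) (out : List (Fin n × P.Msg)) :
    (u.fire m l out).sim adv.corrupt =
      (⟨(u.sim adv.corrupt).world, (u.sim adv.corrupt).note m⟩ : Sim P).absorb
        (adv.leak m.target out) := by
  refine Sim.ext (World.ext' (fun j => ?_) (fun i j => ?_) (fun i j => ?_))
    (World.sim_fire_part _ u m hr l out)
  · simp only [World.sim, World.fire_loc, Sim.absorb]
    split_ifs with h1 h2 <;> simp_all
  · simp only [World.sim, World.fire_sent, Sim.absorb, filter_leak]
    by_cases h1 : i = m.target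
    · subst h1
      by_cases h2 : j ∈ adv.corrupt <;> simp [h2, hm]
    · simp [h1]
  · rcases m with a | a | ⟨a, b, k⟩
    · simp [World.sim, World.fire, World.mark, Sim.absorb]
    · simp [World.sim, World.fire, World.mark, Sim.absorb]
    · simp only [Move.target] at hm
      have := hX a b k rfl
      simp only [World.sim, World.fire, World.mark_deliver, Sim.absorb]
      split_ifs with h1 h2 <;> simp_all

open Classical in
/-- One step of the imitation of an honest execution by the adversary has the right law. -/
theorem simMove_bind (adv : Adversary P) (hD : P.dealer ∉ adv.corrupt) (s s₀ : F) (u : World P)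
    (m : Move n) :
    ((simMove adv.corrupt s₀ m (u.sim adv.corrupt)).bind fun p =>
      (adv.effect s (u.mask adv.corrupt) p.2).map fun x => (x.1, p.1.absorb x.2)) =
    (hstep s u m).map fun u' => (u'.mask adv.corrupt, u'.sim adv.corrupt) := by
  -- A move of a simulated party reads only data known to the simulation. The value `s₀` is
  -- irrelevant since the dealer is not simulated.
  by_cases hm : m.target ∈ adv.corrupt
  · have hr : (u.sim adv.corrupt).world.resp s₀ m = u.resp s m := by
      refine World.resp_congr ?_ ?_ ?_
      · simp [World.sim, hm]
      · rintro i j k rfl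
        simp only [Move.target] at hm
        simp [World.sim, hm]
      · rintro h
        exact absurd (h ▸ hm) hD
    have he : adv.effect s (u.mask adv.corrupt) m.toAction = PMF.pure (u.mask adv.corrupt, []) :=
      effect_toAction_of_corrupt _ _ _ _ hm (by simp [World.mask, hm])
    simp only [simMove, hm, if_true, PMF.bind_map, Function.comp_def, he, PMF.pure_map, absorb_nil]
    change PMF.map (fun x => (u.mask adv.corrupt, (⟨x, (u.sim adv.corrupt).note m⟩ : Sim P))) _ = _
    rw [hstep, hstep, hr]
    cases h : u.resp s m with
    | none =>
      simp only [PMF.pure_map]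
      rw [World.note_sim_of_resp_none h]
    | some p =>
      simp only [PMF.map_comp, Function.comp_def]
      congr 1
      funext x
      rw [World.mask_fire_of_mem u hm, World.sim_fire_of_mem u hm (World.loc_ne_none_of_resp h)]
  -- A move among the outside parties is really carried out; what it sends to the faulty set reaches
  -- the simulation through `absorb`.
  by_cases hX : m.NotFrom adv.corrupt
  · have hs : simMove adv.corrupt s₀ m (u.sim adv.corrupt) =
        PMF.pure (⟨(u.sim adv.corrupt).world, (u.sim adv.corrupt).note m⟩, m.toAction) := by
      unfold simMove
      rw [if_neg hm]
      rcases m with a | a | ⟨a, b, k⟩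
      · rfl
      · rfl
      · have := hX a b k rfl
        have hn : (u.sim adv.corrupt).note (.deliver a b k) = (u.sim adv.corrupt).part := by
          funext b
          simp [Sim.note]
        rw [hn]
        exact if_neg fun h => this h.1
    have hr : (u.mask adv.corrupt).resp s m = u.resp s m := by
      refine World.resp_congr ?_ ?_ fun _ => rfl
      · simp [World.mask, hm]
      · rintro i j k rfl
        have := hX i j k rfl
        simp only [Move.target] at hm
        simp [World.mask, hm, this]
    rw [hs, PMF.pure_bind, effect_toAction _ _ _ _ hm, hr, hstep]
    cases h : u.resp s m with
    | none =>
      simp only [PMF.pure_map, absorb_nil]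
      rw [World.note_sim_of_resp_none h]
    | some p =>
      simp only [PMF.map_comp, Function.comp_def]
      congr 1
      funext x
      rw [World.mask_fire_of_notMem u hm hX,
        World.sim_fire_of_notMem adv u hm hX (World.loc_ne_none_of_resp h)]
  -- There remains a message from a simulated party to an outside one. The real network has no such
  -- message on its channel, so it is injected.
  · obtain ⟨i, j, k, rfl, hi⟩ : ∃ i j k, m = .deliver i j k ∧ i ∈ adv.corrupt := by
      unfold Move.NotFrom at hX
      push Not at hX
      exact hX
    simp only [Move.target] at hm
    have hsent : (u.sim adv.corrupt).world.sent i j = u.sent i j := by simp [World.sim, hi]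
    have hdel : (u.sim adv.corrupt).world.delivered i j = u.delivered i j := by simp [World.sim, hi]
    have hmask : (u.mask adv.corrupt).sent i j = [] := by simp [World.mask, hi]
    have hloc : (u.mask adv.corrupt).loc j = u.loc j := by simp [World.mask, hm]
    have hidle : adv.effect s (u.mask adv.corrupt) (.deliver i j k) =
        PMF.pure (u.mask adv.corrupt, []) := by
      simp only [Adversary.effect, hmask]
      cases (u.mask adv.corrupt).loc j <;> simp
    have hsm : simMove adv.corrupt s₀ (.deliver i j k) (u.sim adv.corrupt) =
        if u.participates j ∧ k ∉ u.delivered i j then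
          match (u.sent i j)[k]? with
          | some x => PMF.pure (⟨{ (u.sim adv.corrupt).world with
              delivered := (u.sim adv.corrupt).world.mark (.deliver i j k) },
                (u.sim adv.corrupt).part⟩, .inject i j x)
          | none => PMF.pure (u.sim adv.corrupt, .deliver i j k)
        else PMF.pure (u.sim adv.corrupt, .deliver i j k) := by
      unfold simMove
      rw [if_neg (show (Move.deliver i j k).target ∉ adv.corrupt from hm)]
      simp only [Move.toAction]
      rw [hsent, hdel]
      by_cases h : u.participates j ∧ k ∉ u.delivered i j
      · rw [if_pos h]
        refine (if_pos ⟨hi, h⟩).trans ?_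
        cases (u.sent i j)[k]? <;> rfl
      · rw [if_neg h, if_neg fun h' => h h'.2]
    rw [hsm]
    simp only [hstep, World.resp]
    cases hl : u.loc j with
    | none =>
      rw [if_neg fun h => by simp [World.participates, hl] at h]
      simp [hidle, PMF.pure_map, absorb_nil]
    | some l =>
      have hp : u.participates j := ⟨l, hl⟩
      cases hx : (u.sent i j)[k]? with
      | none => simp [hidle, PMF.pure_map, absorb_nil]
      | some x =>
        by_cases hk : k ∈ u.delivered i j
        · rw [if_neg fun h => h.2 hk]
          simp [hk, hidle, PMF.pure_map, absorb_nil]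
        · rw [if_pos ⟨hp, hk⟩]
          simp only [hk, if_false, PMF.pure_bind]
          rw [effect_inject adv s _ x hi (hloc.trans hl)]
          simp only [PMF.map_comp, Function.comp_def]
          congr 1
          funext y
          refine Prod.ext ?_ ?_
          · refine World.ext' (fun b => ?_) (fun a b => ?_) (fun a b => ?_)
            · by_cases h : b = j
              · subst h
                simp [World.activate, World.mask, World.fire_loc, Move.target, hm]
              · simp [World.activate, World.mask, World.fire_loc, Move.target, h]
            · by_cases h : a = j
              · subst h
                simp [World.activate, World.mask, World.fire_sent, Move.target, hm]
              · simp [World.activate, World.mask, World.fire_sent, Move.target, h]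
            · simp only [World.activate, World.mask, World.fire_delivered, World.mark_deliver]
              split_ifs with h1 h2 <;> simp_all
          · refine Sim.ext (World.ext' (fun b => ?_) (fun a b => ?_) (fun a b => ?_)) ?_
            · simp only [Sim.absorb, World.sim, World.fire_loc, Move.target]
              split_ifs with h1 h2 <;> simp_all
            · simp only [Sim.absorb, World.sim, World.fire_sent, Move.target, filter_leak]
              by_cases h1 : a = j
              · subst h1
                by_cases h2 : b ∈ adv.corrupt <;> simp [h2, hm]
              · simp [h1]
            · simp only [Sim.absorb, World.sim, World.fire_delivered, World.mark_deliver]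
              split_ifs with h1 h2 <;> simp_all
            · rw [World.sim_fire_part _ _ _ (fun _ => by simp [Move.target, hl])]
              funext b
              simp [Sim.absorb, Sim.note]

/-! ### Histories and laws of honest executions -/

/-- The law of the worlds after each of the first `k` steps of an honest execution. -/
noncomputable def hist (P : Protocol n F) (s : F) (sched : ℕ → Move n) : ℕ → PMF (List (World P))
  | 0 => PMF.pure []
  | k + 1 => (hist P s sched k).bind fun h =>
      -- The initial world is not recorded; the default of `getLastD` supplies it.
      (hstep s (h.getLastD (World.init P)) (sched k)).map fun w => h ++ [w]

/-- The law of the world after `k` honest steps from `w`. -/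
noncomputable def chain (s : F) (sched : ℕ → Move n) (w : World P) : ℕ → PMF (World P)
  | 0 => PMF.pure w
  | k + 1 => (chain s sched w k).bind fun u => hstep s u (sched k)

theorem hist_map_last (s : F) (sched : ℕ → Move n) (k : ℕ) :
    (hist P s sched k).map (fun h => h.getLastD (World.init P)) =
      chain s sched (World.init P) k := by
  induction k with
  | zero => simp [hist, chain, PMF.pure_map]
  | succ k ih =>
    rw [chain, ← ih, hist, PMF.map_bind, PMF.bind_map]
    congr 1
    funext h
    rw [PMF.map_comp]
    simp only [Function.comp_def, List.getLastD_concat]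
    exact PMF.map_id _

theorem Adversary.run_map_fst_succ (adv : Adversary P) (s : F) (k : ℕ) :
    (adv.run s (k + 1)).map Prod.fst = ((adv.run s k).map Prod.fst).bind (adv.step s) := by
  rw [Adversary.run, PMF.map_bind, PMF.bind_map]
  congr 1
  funext h
  rw [PMF.map_comp]
  exact PMF.map_id _

/-! ### Locality and monotonicity of honest steps -/

section Locality

variable {s : F} {w w' : World P} {m : Move n}

theorem loc_of_hstep (h : w' ∈ (hstep s w m).support) {j : Fin n} (hj : j ≠ m.target) :
    w'.loc j = w.loc j := by
  rcases mem_support_hstep.1 h with ⟨-, rfl⟩ | ⟨p, -, x, -, rfl⟩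
  · rfl
  · simp [World.fire_loc, hj]

theorem sent_of_hstep (h : w' ∈ (hstep s w m).support) {i : Fin n} (hi : i ≠ m.target)
    (j : Fin n) : w'.sent i j = w.sent i j := by
  rcases mem_support_hstep.1 h with ⟨-, rfl⟩ | ⟨p, -, x, -, rfl⟩
  · rfl
  · simp [World.fire_sent, hi]

theorem delivered_of_hstep (h : w' ∈ (hstep s w m).support) {j : Fin n} (hj : j ≠ m.target)
    (i : Fin n) : w'.delivered i j = w.delivered i j := by
  rcases mem_support_hstep.1 h with ⟨-, rfl⟩ | ⟨p, -, x, -, rfl⟩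
  · rfl
  · exact World.mark_of_ne_target w m i hj

/-- How the record of a party may change in a step. -/
theorem local_of_hstep (h : w' ∈ (hstep s w m).support) {j : Fin n} {l : Local P}
    (hl : w.loc j = some l) : ∃ l', w'.loc j = some l' ∧ (l.shared = true → l'.shared = true) ∧
      (l.begun = true → l'.begun = true) := by
  rcases mem_support_hstep.1 h with ⟨-, rfl⟩ | ⟨p, hp, x, hx, rfl⟩
  · exact ⟨l, hl, id, id⟩
  by_cases hj : j = m.target
  · refine ⟨x.1, by simp [World.fire_loc, hj], ?_⟩
    rcases m with a | a | ⟨i, a, k⟩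
    · simp only [Move.target] at hj
      subst hj
      simp [World.resp, hl] at hp
    · simp only [Move.target] at hj
      subst hj
      simp only [World.resp, hl] at hp
      split_ifs at hp with hc
      cases hp
      simp only [PMF.support_map, Set.mem_image] at hx
      obtain ⟨y, -, rfl⟩ := hx
      simp [Local.advance, hc]
    · simp only [Move.target] at hj
      subst hj
      simp only [World.resp, hl] at hp
      cases hm : (w.sent i j)[k]? with
      | none => simp [hm] at hp
      | some msg =>
        simp only [hm] at hp
        split_ifs at hp with hc
        cases hp
        simp only [PMF.support_map, Set.mem_image] at hx
        obtain ⟨y, -, rfl⟩ := hx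
        simp +contextual [Local.advance]
  · exact ⟨l, by simp [World.fire_loc, hj, hl], id, id⟩

theorem participates_of_hstep (h : w' ∈ (hstep s w m).support) {j : Fin n}
    (hj : w.participates j) : w'.participates j := by
  obtain ⟨l, hl⟩ := hj
  obtain ⟨l', hl', -⟩ := local_of_hstep h hl
  exact ⟨l', hl'⟩

theorem completedS_of_hstep (h : w' ∈ (hstep s w m).support) {j : Fin n}
    (hj : w.completedS j) : w'.completedS j := by
  obtain ⟨l, hl, hs⟩ := hj
  obtain ⟨l', hl', h1, -⟩ := local_of_hstep h hl
  exact ⟨l', hl', h1 hs⟩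

theorem begunR_of_hstep (h : w' ∈ (hstep s w m).support) {j : Fin n}
    (hj : w.begunR j) : w'.begunR j := by
  obtain ⟨l, hl, hs⟩ := hj
  obtain ⟨l', hl', -, h1⟩ := local_of_hstep h hl
  exact ⟨l', hl', h1 hs⟩

theorem participates_of_hstep_startS {j : Fin n} (h : w' ∈ (hstep s w (.startS j)).support) :
    w'.participates j := by
  rcases mem_support_hstep.1 h with ⟨h0, rfl⟩ | ⟨p, hp, x, hx, rfl⟩
  · exact (World.participates_iff _ _).2 (World.loc_ne_none_of_resp_none h0)
  · exact ⟨x.1, by simp [World.fire_loc, Move.target]⟩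

theorem begunR_of_hstep_startR {j : Fin n} (h : w' ∈ (hstep s w (.startR j)).support)
    (hj : w.completedS j) : w'.begunR j := by
  obtain ⟨l, hl, hs⟩ := hj
  by_cases hb : l.begun = true
  · exact begunR_of_hstep h ⟨l, hl, hb⟩
  rcases mem_support_hstep.1 h with ⟨h0, rfl⟩ | ⟨p, hp, x, hx, rfl⟩
  · simp [World.resp, hl, hs, hb] at h0
  · refine ⟨x.1, by simp [World.fire_loc, Move.target], ?_⟩
    simp only [World.resp, hl, hs, hb] at hp
    simp only [and_self, if_true, Option.some.injEq] at hp
    subst hp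
    simp only [PMF.support_map, Set.mem_image] at hx
    obtain ⟨y, -, rfl⟩ := hx
    simp [Local.advance]

end Locality

/-! ### Validity of schedules -/

section Fairness

variable (adv : Adversary P)

/-- What an action can do to the world. -/
theorem effect_support {s : F} {w : World P} {a : Action P}
    {x : World P × List (Fin n × Fin n × P.Msg)} (hx : x ∈ (adv.effect s w a).support) :
    x.1 = w ∨ ∃ j l out D, x.1 = { w.activate j l out with delivered := D } ∧
      (j ∉ adv.corrupt ∨ w.loc j ≠ none) ∧ ∀ i j, w.delivered i j ⊆ D i j := by
  rcases a with j | j | ⟨i, j, k⟩ | ⟨i, j, m⟩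
  · simp only [Adversary.effect] at hx
    cases hl : w.loc j with
    | some l => left; simp_all
    | none =>
      simp only [hl] at hx
      by_cases hc : j ∈ adv.corrupt
      · left; simp_all
      · rw [if_neg hc] at hx
        simp only [PMF.support_map, Set.mem_image] at hx
        obtain ⟨y, -, rfl⟩ := hx
        exact .inr ⟨j, _, _, _, rfl, .inl hc, fun _ _ => subset_rfl⟩
  · simp only [Adversary.effect] at hx
    cases hl : w.loc j with
    | none => left; simp_all
    | some l =>
      simp only [hl] at hx
      split_ifs at hx with hc
      · simp only [PMF.support_map, Set.mem_image] at hx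
        obtain ⟨y, -, rfl⟩ := hx
        exact .inr ⟨j, _, _, _, rfl, .inr (by simp [hl]), fun _ _ => subset_rfl⟩
      · left; simp_all
  · simp only [Adversary.effect] at hx
    cases hl : w.loc j with
    | none => left; simp_all
    | some l =>
      cases hm : (w.sent i j)[k]? with
      | none => left; simp_all
      | some m =>
        simp only [hl, hm] at hx
        split_ifs at hx with hc
        · left; simp_all
        · simp only [PMF.support_map, Set.mem_image] at hx
          obtain ⟨y, -, rfl⟩ := hx
          refine .inr ⟨j, _, _, _, rfl, .inr (by simp [hl]), fun a b => ?_⟩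
          have := World.mark_deliver w i j a b k
          simp only [World.mark] at this
          rw [this]
          split_ifs with h
          · rw [h.1, h.2]; exact Finset.subset_insert _ _
          · exact subset_rfl
  · simp only [Adversary.effect] at hx
    cases hl : w.loc j with
    | none => left; simp_all
    | some l =>
      simp only [hl] at hx
      split_ifs at hx with hc
      · simp only [PMF.support_map, Set.mem_image] at hx
        obtain ⟨y, -, rfl⟩ := hx
        exact .inr ⟨j, _, _, _, rfl, .inr (by simp [hl]), fun _ _ => subset_rfl⟩
      · left; simp_all

variable {adv}

theorem mem_support_step {s : F} {c c' : adv.Config} (h : c' ∈ (adv.step s c).support) :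
    ∃ a ∈ (adv.next c.2).support, ∃ x ∈ (adv.effect s c.1 a.2).support,
      c' = (x.1, c.2 ++ [(a.1, a.2, x.2)]) := by
  simp only [Adversary.step, PMF.mem_support_bind_iff, PMF.support_map, Set.mem_image] at h
  obtain ⟨a, ha, x, hx, rfl⟩ := h
  exact ⟨a, ha, x, hx, rfl⟩

theorem view_length {s : F} {ω : ℕ → adv.Config} (h : adv.IsExecution s ω) (k : ℕ) :
    (ω k).2.length = k := by
  induction k with
  | zero => simp [h.1]
  | succ k ih =>
    obtain ⟨a, -, x, -, hx⟩ := mem_support_step (h.2 k)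
    simp [hx, ih]

theorem idle_of_corrupt {s : F} {ω : ℕ → adv.Config} (h : adv.IsExecution s ω) (k : ℕ)
    {i : Fin n} (hi : i ∈ adv.corrupt) :
    (ω k).1.loc i = none ∧ ∀ j, (ω k).1.sent i j = [] := by
  induction k with
  | zero => simp [h.1, World.init]
  | succ k ih =>
    obtain ⟨a, -, x, hx, hω⟩ := mem_support_step (h.2 k)
    rw [hω]
    rcases effect_support adv hx with he | ⟨j, l, out, D, he, hj, -⟩
    · rw [he]; exact ih
    · have hne : i ≠ j := by
        rintro rfl
        exact hj.elim (fun h => h hi) fun h => h ih.1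
      simp [he, World.activate, hne, ih.1, ih.2]

theorem execution_mono {s : F} {ω : ℕ → adv.Config} (h : adv.IsExecution s ω) (i j : Fin n)
    {τ τ' : ℕ} (hτ : τ ≤ τ') :
    ((ω τ).1.participates j → (ω τ').1.participates j) ∧
      ((ω τ).1.sent i j).length ≤ ((ω τ').1.sent i j).length := by
  induction τ', hτ using Nat.le_induction with
  | base => exact ⟨id, le_rfl⟩
  | succ k _ ih =>
    obtain ⟨a, -, x, hx, hω⟩ := mem_support_step (h.2 k)
    rw [hω]
    rcases effect_support adv hx with he | ⟨b, l, out, D, he, -, -⟩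
    · rw [he]; exact ih
    · rw [he]
      refine ⟨fun hp => ?_, ih.2.trans ?_⟩
      · have := (World.participates_iff _ _).1 (ih.1 hp)
        rw [World.participates_iff]
        by_cases hb : j = b
        · simp [World.activate, hb]
        · simpa [World.activate, hb] using this
      · by_cases hb : i = b
        · subst hb; simp [World.activate]
        · simp [World.activate, hb]

/-- A scheduler that tries each delivery again and again is valid. -/
theorem fair_of_deliver (hf : ∀ i ∉ adv.corrupt, ∀ j ∉ adv.corrupt, ∀ k N, ∃ τ ≥ N,
    ∀ v, v.length = τ → ∀ a ∈ (adv.next v).support, a.2 = .deliver i j k) : adv.Fair := by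
  intro s ω hω i j τ k hk hp
  have hi : i ∉ adv.corrupt := fun hi => by simp [(idle_of_corrupt hω τ hi).2] at hk
  have hj : j ∉ adv.corrupt := fun hj =>
    (World.participates_iff _ _).1 hp (idle_of_corrupt hω τ hj).1
  -- At the next attempt after `τ` the message still exists and its recipient still participates, so
  -- it is delivered then unless this has already happened.
  obtain ⟨τ', hτ', hd⟩ := hf i hi j hj k τ
  refine ⟨τ' + 1, ?_⟩
  obtain ⟨hp', hl⟩ := execution_mono hω i j hτ'
  obtain ⟨l, hl'⟩ := hp' hp
  obtain ⟨a, ha, x, hx, hω'⟩ := mem_support_step (hω.2 τ')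
  rw [hω']
  rw [hd _ (view_length hω τ') a ha] at hx
  have hm := List.getElem?_eq_getElem (hk.trans_le hl)
  simp only [Adversary.effect, hl', hm] at hx
  split_ifs at hx with hc
  · simp only [PMF.support_pure, Set.mem_singleton_iff] at hx
    rw [hx]; exact hc
  · simp only [PMF.support_map, Set.mem_image] at hx
    obtain ⟨y, -, rfl⟩ := hx
    simp

end Fairness

/-! ### Discrete laws and adversaries with a fixed list of actions -/

theorem pmf_bind_congr {α β : Type*} {p : PMF α} {f g : α → PMF β}
    (h : ∀ a ∈ p.support, f a = g a) : p.bind f = p.bind g := by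
  ext b
  rw [PMF.bind_apply, PMF.bind_apply]
  refine tsum_congr fun a => ?_
  by_cases ha : a ∈ p.support
  · rw [h a ha]
  · rw [PMF.mem_support_iff, not_not] at ha
    simp [ha]

theorem pmf_map_congr {α β : Type*} {p : PMF α} {f g : α → β}
    (h : ∀ a ∈ p.support, f a = g a) : p.map f = p.map g :=
  pmf_bind_congr fun a ha => by simp [h a ha]

theorem pmf_outer_le_one {α : Type*} (p : PMF α) (A : Set α) : p.toOuterMeasure A ≤ 1 := by
  rw [PMF.toOuterMeasure_apply, ← p.tsum_coe]
  exact ENNReal.tsum_le_tsum fun a => Set.indicator_le_self A p a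

/-- Ending outside `B` requires starting outside `A`. This carries bounds on failure probabilities
through random steps. -/
theorem pmf_bind_compl_le {α β : Type*} (p : PMF α) (q : α → PMF β) {A : Set α} {B : Set β}
    (h : ∀ a ∈ A, ∀ b ∈ (q a).support, b ∈ B) :
    (p.bind q).toOuterMeasure Bᶜ ≤ p.toOuterMeasure Aᶜ := by
  rw [PMF.toOuterMeasure_bind_apply, PMF.toOuterMeasure_apply]
  refine ENNReal.tsum_le_tsum fun a => ?_
  by_cases ha : a ∈ A
  · have : (q a).toOuterMeasure Bᶜ = 0 := by
      rw [PMF.toOuterMeasure_apply_eq_zero_iff, Set.disjoint_left]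
      exact fun b hb hb' => hb' (h a ha b hb)
    simp [this]
  · rw [Set.indicator_of_mem (show a ∈ Aᶜ from ha)]
    exact mul_le_of_le_one_right' (pmf_outer_le_one _ _)

/-- The law of the world after `k` steps. -/
noncomputable def Adversary.worlds (adv : Adversary P) (s : F) (k : ℕ) : PMF (World P) :=
  (adv.run s k).map fun h => h.1.1

theorem Adversary.prob_world (adv : Adversary P) (s : F) (k : ℕ) (E : World P → Prop) :
    adv.prob s k (fun h => E h.1.1) = (adv.worlds s k).toOuterMeasure {w | E w} := by
  rw [Adversary.worlds, PMF.toOuterMeasure_map_apply]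
  rfl

theorem Adversary.length_of_mem_run (adv : Adversary P) (s : F) (k : ℕ) {c : adv.Config}
    (hc : c ∈ ((adv.run s k).map Prod.fst).support) : c.2.length = k := by
  induction k generalizing c with
  | zero => simp [Adversary.run, PMF.pure_map] at hc; simp [hc]
  | succ k ih =>
    rw [Adversary.run_map_fst_succ, PMF.mem_support_bind_iff] at hc
    obtain ⟨b, hb, hc⟩ := hc
    obtain ⟨a, -, x, -, rfl⟩ := mem_support_step hc
    simp [ih hb]

/-- The adversary that carries out a fixed list of actions. -/
noncomputable def Adversary.ofSched (X : Finset (Fin n)) (acts : ℕ → Action P) : Adversary P where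
  corrupt := X
  Coin := PUnit
  next v := PMF.pure (⟨⟩, acts v.length)

theorem Adversary.worlds_zero (adv : Adversary P) (s : F) :
    adv.worlds s 0 = PMF.pure (World.init P) := by
  simp [Adversary.worlds, Adversary.run, PMF.pure_map]

theorem Adversary.worlds_ofSched_succ (X : Finset (Fin n)) (acts : ℕ → Action P) (s : F) (k : ℕ) :
    (Adversary.ofSched X acts).worlds s (k + 1) =
      ((Adversary.ofSched X acts).worlds s k).bind fun w =>
        ((Adversary.ofSched X acts).effect s w (acts k)).map Prod.fst := by
  have h1 : ∀ k, (Adversary.ofSched X acts).worlds s k =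
      (((Adversary.ofSched X acts).run s k).map Prod.fst).map Prod.fst := by
    intro k; rw [PMF.map_comp]; rfl
  rw [h1, h1, Adversary.run_map_fst_succ, PMF.map_bind]
  conv_rhs => rw [PMF.bind_map]
  refine pmf_bind_congr fun c hc => ?_
  have hl := Adversary.length_of_mem_run _ _ _ hc
  have hn : (Adversary.ofSched X acts).next c.2 = PMF.pure (⟨⟩, acts k) := by
    rw [← hl]; rfl
  rw [Adversary.step, hn, PMF.pure_bind, PMF.map_comp]
  rfl

/-! ### Covering schedules and hybrid worlds produced by a faulty dealer's set -/

/-- The moves that the honest parties outside `D` can carry out among themselves. -/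
def movesOff (D : Finset (Fin n)) : Set (Move n) := {m | m.target ∉ D ∧ m.NotFrom D}

/-- The same without the reconstruction phase. -/
def shareMovesOff (D : Finset (Fin n)) : Set (Move n) := {m ∈ movesOff D | ∀ j, m ≠ .startR j}

/-- The schedule consists of the moves in `G`, each of them infinitely often. -/
structure Covers (G : Set (Move n)) (sched : ℕ → Move n) : Prop where
  mem : ∀ k, sched k ∈ G
  often : ∀ m ∈ G, ∀ N, ∃ k ≥ N, sched k = m

/-- There are countably many moves, and the first component of `Nat.unpair` takes every value at
arbitrarily late arguments. -/
theorem exists_covers {G : Set (Move n)} (hG : G.Nonempty) : ∃ sched, Covers G sched := by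
  have : Countable (Move n) := by
    let f : Move n → Fin 3 × Fin n × Fin n × ℕ
      | .startS j => (0, j, j, 0)
      | .startR j => (1, j, j, 0)
      | .deliver i j k => (2, i, j, k)
    refine Function.Injective.countable (f := f) ?_
    rintro (a | a | ⟨a, b, k⟩) (a' | a' | ⟨a', b', k'⟩) h <;> simp_all [f]
  have : Nonempty G := hG.to_subtype
  obtain ⟨g, hg⟩ := exists_surjective_nat G
  refine ⟨fun k => g (Nat.unpair k).1, fun k => (g _).2, fun m hm N => ?_⟩
  obtain ⟨a, ha⟩ := hg ⟨m, hm⟩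
  exact ⟨Nat.pair a N, Nat.right_le_pair a N, by simp [ha]⟩

/-- The world in which each party outside `D` has its data from its own source. -/
def assemble (D : Finset (Fin n)) (U : Fin n → World P) : World P where
  loc j := if j ∈ D then none else (U j).loc j
  sent i j := if i ∈ D then [] else (U i).sent i j
  -- A channel is split between two sources: what was sent is taken from the sender's, what was
  -- delivered from the recipient's. Agreement of the sources is a separate hypothesis below.
  delivered i j := if i ∈ D ∨ j ∈ D then ∅ else (U j).delivered i j

theorem assemble_eq_of_hstep {D : Finset (Fin n)} {U U' : Fin n → World P} {m : Move n}
    {sec : Fin n → F} (hU : ∀ j ∉ D, U' j ∈ (hstep (sec j) (U j) m).support)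
    (hm : m.target ∈ D ∨ U' m.target = U m.target) : assemble D U' = assemble D U := by
  have key : ∀ j ∉ D, (U' j).loc j = (U j).loc j ∧ (∀ i, (U' j).sent j i = (U j).sent j i) ∧
      ∀ i, (U' j).delivered i j = (U j).delivered i j := by
    intro j hj
    by_cases h : j = m.target
    · subst h
      rw [hm.resolve_left hj]
      simp
    · exact ⟨loc_of_hstep (hU j hj) h, sent_of_hstep (hU j hj) h, delivered_of_hstep (hU j hj) h⟩
  refine World.ext' (fun j => ?_) (fun i j => ?_) (fun i j => ?_)
  · simp only [assemble]
    split_ifs with h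
    · rfl
    · exact (key j h).1
  · simp only [assemble]
    split_ifs with h
    · rfl
    · exact (key i h).2.1 j
  · simp only [assemble]
    split_ifs with h
    · rfl
    · exact (key j fun h' => h (.inr h')).2.2 i

theorem assemble_fire_of_hstep {D : Finset (Fin n)} {U U' : Fin n → World P} {m : Move n}
    {sec : Fin n → F} (hU : ∀ j ∉ D, U' j ∈ (hstep (sec j) (U j) m).support)
    (hm : m.target ∉ D) {l : Local P} {out : List (Fin n × P.Msg)}
    (hf : U' m.target = (U m.target).fire m l out) :
    (∀ j, (assemble D U').loc j = if j = m.target then some l else (assemble D U).loc j) ∧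
    (∀ i j, (assemble D U').sent i j = (assemble D U).sent i j ++
      if i = m.target then (out.filter fun x => x.1 = j).map Prod.snd else []) ∧
    ∀ i j, (assemble D U').delivered i j =
      if i ∉ D ∧ j = m.target then (U j).mark m i j else (assemble D U).delivered i j := by
  refine ⟨fun j => ?_, fun i j => ?_, fun i j => ?_⟩
  · by_cases hj : j = m.target
    · subst hj
      simp [assemble, hm, hf, World.fire_loc]
    · by_cases hD : j ∈ D
      · simp [assemble, hj, hD]
      · simp [assemble, hj, hD, loc_of_hstep (hU j hD) hj]
  · by_cases hj : i = m.target
    · subst hj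
      simp [assemble, hm, hf, World.fire_sent]
    · by_cases hD : i ∈ D
      · simp [assemble, hj, hD]
      · simp [assemble, hj, hD, sent_of_hstep (hU i hD) hj]
  · by_cases hj : j = m.target
    · subst hj
      by_cases hi : i ∈ D <;> simp [assemble, hm, hf, World.fire_delivered, hi]
    · by_cases hD : j ∈ D
      · simp [assemble, hj, hD]
      · simp [assemble, hj, hD, delivered_of_hstep (hU j hD) hj]

/-- If every party outside `D` takes part in the move as in its own source, the adversary that
controls `D` can bring this about with positive probability. -/
theorem exists_action {D : Finset (Fin n)} (hD : P.dealer ∈ D) {U U' : Fin n → World P}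
    {m : Move n} {sec : Fin n → F}
    (hU : ∀ j ∉ D, U' j ∈ (hstep (sec j) (U j) m).support)
    (hc : m.target ∉ D → ∀ i ∉ D, (U i).sent i m.target = (U m.target).sent i m.target) :
    ∃ a, ∀ (adv : Adversary P) (s : F), adv.corrupt = D →
      assemble D U' ∈ ((adv.effect s (assemble D U) a).map Prod.fst).support := by
  by_cases hm : m.target ∈ D
  -- Activations of `D` take place in the sources only; the assembled world does not notice them.
  · refine ⟨m.toAction, fun adv s had => ?_⟩
    rw [effect_toAction_of_corrupt adv s _ m (had ▸ hm) (by simp [assemble, hm]),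
      assemble_eq_of_hstep hU (.inl hm)]
    simp [PMF.pure_map]
  by_cases hX : m.NotFrom D
  · refine ⟨m.toAction, fun adv s had => ?_⟩
    rw [effect_toAction_fst adv s _ m (had ▸ hm), mem_support_hstep]
    have hr : (assemble D U).resp s m = (U m.target).resp (sec m.target) m := by
      refine World.resp_congr (by simp [assemble, hm]) ?_ fun h => absurd (h ▸ hD) hm
      rintro i j k rfl
      have hi := hX i j k rfl
      have hs := hc hm i hi
      simp only [Move.target] at hm hs ⊢
      simp [assemble, hm, hi, hs]
    rw [hr]
    rcases mem_support_hstep.1 (hU _ hm) with ⟨h0, h1⟩ | ⟨p, h0, x, hx, h1⟩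
    · exact .inl ⟨h0, assemble_eq_of_hstep hU (.inr h1)⟩
    · refine .inr ⟨p, h0, x, hx, ?_⟩
      obtain ⟨e1, e2, e3⟩ := assemble_fire_of_hstep hU hm h1
      refine World.ext' (fun j => ?_) (fun i j => ?_) (fun i j => ?_)
      · rw [e1, World.fire_loc]
      · rw [e2, World.fire_sent]
      · rw [e3, World.fire_delivered]
        by_cases hj : j = m.target
        · subst hj
          by_cases hi : i ∈ D
          · rw [if_neg (by simp [hi])]
            rcases m with a | a | ⟨a, b, k⟩
            · rfl
            · rfl
            · rw [World.mark_deliver, if_neg]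
              rintro ⟨rfl, -⟩
              exact hX _ _ _ rfl hi
          · rw [if_pos ⟨hi, rfl⟩]
            rcases m with a | a | ⟨a, b, k⟩
            · simp only [Move.target] at hm ⊢
              simp [World.mark, assemble, hi, hm]
            · simp only [Move.target] at hm ⊢
              simp [World.mark, assemble, hi, hm]
            · have ha := hX a b k rfl
              simp only [Move.target] at hm ⊢
              simp [World.mark_deliver, assemble, hi, hm, ha]
        · rw [if_neg (by simp [hj]), World.mark_of_ne_target _ _ _ hj]
  -- A message from `D` is injected exactly as the source of its recipient has it. Sources of
  -- different recipients may disagree on what `D` sends.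
  · obtain ⟨i, j, k, rfl, hi⟩ : ∃ i j k, m = .deliver i j k ∧ i ∈ D := by
      unfold Move.NotFrom at hX
      push Not at hX
      exact hX
    simp only [Move.target] at hm
    rcases mem_support_hstep.1 (hU _ hm) with ⟨h0, h1⟩ | ⟨p, h0, x, hx, h1⟩
    · refine ⟨.deliver i j k, fun adv s had => ?_⟩
      rw [assemble_eq_of_hstep hU (.inr h1)]
      have hs : (assemble D U).sent i j = [] := by simp [assemble, hi]
      simp only [Adversary.effect, hs]
      cases (assemble D U).loc j <;> simp [PMF.pure_map]
    · simp only [World.resp] at h0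
      cases hl : (U j).loc j with
      | none => simp [hl] at h0
      | some l =>
        cases hs : ((U j).sent i j)[k]? with
        | none => simp [hl, hs] at h0
        | some y =>
          simp only [hl, hs] at h0
          split_ifs at h0 with hk
          cases h0
          refine ⟨.inject i j y, fun adv s had => ?_⟩
          subst had
          rw [effect_inject adv s _ y hi (l := l) (by simp [assemble, hm, hl])]
          simp only [PMF.support_map, Set.mem_image] at hx ⊢
          obtain ⟨z, hz, rfl⟩ := hx
          refine ⟨_, ⟨z, hz, rfl⟩, ?_⟩
          obtain ⟨e1, e2, e3⟩ := assemble_fire_of_hstep hU hm h1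
          refine World.ext' (fun a => ?_) (fun a b => ?_) (fun a b => ?_)
          · rw [e1]
            by_cases ha : a = j
            · subst ha; simp [World.activate, Move.target]
            · simp [World.activate, Move.target, ha]
          · rw [e2]
            by_cases ha : a = j
            · subst ha; simp [World.activate, Move.target]
            · simp [World.activate, Move.target, ha]
          · rw [e3]
            simp only [World.activate]
            by_cases hab : a ∉ adv.corrupt ∧ b = j
            · obtain ⟨ha, rfl⟩ := hab
              have : a ≠ i := by rintro rfl; exact ha hi
              rw [if_pos ⟨ha, rfl⟩, World.mark_deliver, if_neg fun h => this h.1]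
              simp [assemble, ha, hm]
            · exact (if_neg hab).symm

/-- The actions of `exists_action` are strung together. They need not react to anything, since only
positive probability is claimed. The actions from time `K` on are left free, so that a valid
schedule can be appended. -/
theorem exists_acts {D : Finset (Fin n)} (hD : P.dealer ∈ D) {U : ℕ → Fin n → World P}
    {sched : ℕ → Move n} {sec : Fin n → F} {K : ℕ}
    (h0 : ∀ j, U 0 j = World.init P)
    (hU : ∀ τ < K, ∀ j ∉ D, U (τ + 1) j ∈ (hstep (sec j) (U τ j) (sched τ)).support)
    (hc : ∀ τ < K, (sched τ).target ∉ D → ∀ i ∉ D,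
      (U τ i).sent i (sched τ).target = (U τ (sched τ).target).sent i (sched τ).target) :
    ∃ acts : ℕ → Action P, ∀ acts' : ℕ → Action P, (∀ τ < K, acts' τ = acts τ) → ∀ s, ∀ τ ≤ K,
      assemble D (U τ) ∈ ((Adversary.ofSched D acts').worlds s τ).support := by
  have hex : ∀ τ, ∃ a, τ < K → ∀ (adv : Adversary P) (s : F), adv.corrupt = D →
      assemble D (U (τ + 1)) ∈ ((adv.effect s (assemble D (U τ)) a).map Prod.fst).support := by
    intro τ
    by_cases hτ : τ < K
    · obtain ⟨a, ha⟩ := exists_action hD (hU τ hτ) (hc τ hτ)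
      exact ⟨a, fun _ => ha⟩
    · exact ⟨.startS P.dealer, fun h => absurd h hτ⟩
  choose acts hacts using hex
  refine ⟨acts, fun acts' ha s τ hτ => ?_⟩
  induction τ with
  | zero =>
    rw [Adversary.worlds_zero, PMF.support_pure, Set.mem_singleton_iff]
    refine World.ext' (fun j => ?_) (fun i j => ?_) (fun i j => ?_) <;>
      simp [assemble, h0, World.init]
  | succ τ ih =>
    rw [Adversary.worlds_ofSched_succ, PMF.mem_support_bind_iff]
    refine ⟨_, ih (by omega), ?_⟩
    rw [ha τ (by omega)]
    exact hacts τ (by omega) _ s rfl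

/-- A move whose target is nonfaulty has the same effect as in an honest execution, so from time `K`
on the world evolves as `chain`. -/
theorem worlds_ofSched_add {D : Finset (Fin n)} {acts : ℕ → Action P} {sched : ℕ → Move n} {K : ℕ}
    (ha : ∀ m, acts (K + m) = (sched m).toAction) (hs : ∀ m, (sched m).target ∉ D) (s : F)
    (m : ℕ) : (Adversary.ofSched D acts).worlds s (K + m) =
      ((Adversary.ofSched D acts).worlds s K).bind fun w => chain s sched w m := by
  induction m with
  | zero => simp [chain]
  | succ m ih =>
    rw [← add_assoc, Adversary.worlds_ofSched_succ, ih, PMF.bind_bind]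
    congr 1
    funext w
    rw [chain]
    congr 1
    funext u
    rw [ha, effect_toAction_fst _ _ _ _ (hs m)]

theorem mul_outer_le_bind {α β : Type*} (p : PMF α) (q : α → PMF β) (a : α) (E : Set β) :
    p a * (q a).toOuterMeasure E ≤ (p.bind q).toOuterMeasure E := by
  rw [PMF.toOuterMeasure_bind_apply]
  exact ENNReal.le_tsum a

/-! ### Reconstruction without the dealer's set -/

section Chain

variable {s : F} {sched : ℕ → Move n} {w₀ : World P}

theorem chain_step_le {A B : Set (World P)} {m : ℕ}
    (h : ∀ w ∈ A, ∀ w' ∈ (hstep s w (sched m)).support, w' ∈ B) :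
    (chain s sched w₀ (m + 1)).toOuterMeasure Bᶜ ≤ (chain s sched w₀ m).toOuterMeasure Aᶜ :=
  pmf_bind_compl_le _ _ h

theorem chain_antitone {A : Set (World P)}
    (h : ∀ w ∈ A, ∀ a, ∀ w' ∈ (hstep s w a).support, w' ∈ A) :
    Antitone fun m => (chain s sched w₀ m).toOuterMeasure Aᶜ :=
  antitone_nat_of_succ_le fun _ => chain_step_le fun w hw => h w hw _

theorem chain_participates {j : Fin n} {N : ℕ} (hN : sched N = .startS j) {m : ℕ} (hm : N < m) :
    (chain s sched w₀ m).toOuterMeasure {w | w.participates j}ᶜ = 0 := by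
  have h1 := chain_antitone (s := s) (sched := sched) (w₀ := w₀) (A := {w | w.participates j})
    (fun w hw _ _ h => participates_of_hstep h hw) hm
  have h2 : (chain s sched w₀ (N + 1)).toOuterMeasure {w | w.participates j}ᶜ ≤ _ :=
    chain_step_le (A := Set.univ) fun w _ w' hw' => by
      rw [hN] at hw'
      exact participates_of_hstep_startS hw'
  simpa using h1.trans h2

/-- A call of `R` before the completion of `S` is void. So one waits until completion is almost
certain and then for the next call. -/
theorem chain_begunR {j : Fin n} (hs : ∀ N, ∃ k ≥ N, sched k = .startR j)
    (h : Tendsto (fun m => (chain s sched w₀ m).toOuterMeasure {w | w.completedS j}ᶜ)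
      atTop (𝓝 0)) :
    Tendsto (fun m => (chain s sched w₀ m).toOuterMeasure {w | w.begunR j}ᶜ) atTop (𝓝 0) := by
  rw [ENNReal.tendsto_atTop_zero] at h ⊢
  intro ε hε
  obtain ⟨N, hN⟩ := h ε hε
  obtain ⟨k, hk, hsk⟩ := hs N
  refine ⟨k + 1, fun m hm => ?_⟩
  refine (chain_antitone (fun w hw _ _ h => begunR_of_hstep h hw) hm).trans ?_
  refine le_trans (chain_step_le (A := {w | w.completedS j}) fun w hw w' hw' => ?_) (hN k hk)
  rw [hsk] at hw'
  exact begunR_of_hstep_startR hw' hw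

end Chain

/-- Parties outside `D` that hold what they may have received from `D`, one of them having
completed the sharing, reconstruct almost surely, even if nothing more is heard of `D`. -/
theorem chain_terminates {t : ℕ} {δ : ℝ} (hP : P.IsAVSS t δ) {D : Finset (Fin n)}
    (hD : P.dealer ∈ D) (hcard : D.card ≤ t) {U : ℕ → Fin n → World P}
    {sched sched₂ : ℕ → Move n} {sec : Fin n → F} {K : ℕ}
    (h0 : ∀ j, U 0 j = World.init P)
    (hU : ∀ τ < K, ∀ j ∉ D, U (τ + 1) j ∈ (hstep (sec j) (U τ j) (sched τ)).support)
    (hc : ∀ τ < K, (sched τ).target ∉ D → ∀ i ∉ D,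
      (U τ i).sent i (sched τ).target = (U τ (sched τ).target).sent i (sched τ).target)
    (h₂ : Covers (movesOff D) sched₂) {a : Fin n} (ha : a ∉ D) (has : (U K a).completedS a)
    {c : Fin n} (hcD : c ∉ D) (s : F) :
    Tendsto (fun m => (chain s sched₂ (assemble D (U K)) m).toOuterMeasure
      {w | w.completedS c ∧ ∃ v, w.outputs c v}ᶜ) atTop (𝓝 0) := by
  obtain ⟨acts, hacts⟩ := exists_acts hD h0 hU hc
  set w₀ := assemble D (U K) with hw₀
  -- The faulty set `D` steers towards `w₀` and then falls silent, while the others continue with a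
  -- covering schedule.
  let acts' : ℕ → Action P := fun τ => if τ < K then acts τ else (sched₂ (τ - K)).toAction
  let adv := Adversary.ofSched D acts'
  have htail : ∀ m, acts' (K + m) = (sched₂ m).toAction := fun m => by simp [acts']
  have hp0 : adv.worlds s K w₀ ≠ 0 :=
    hacts acts' (fun τ hτ => by simp [acts', hτ]) s K le_rfl
  have hfair : adv.Fair := by
    refine fair_of_deliver fun i hi j hj k N => ?_
    obtain ⟨τ, hτ, hs⟩ := h₂.often (.deliver i j k) ⟨hj, by rintro _ _ _ ⟨⟩; exact hi⟩ N
    refine ⟨K + τ, by omega, fun v hv b hb => ?_⟩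
    have : b = (⟨⟩, acts' v.length) := (PMF.mem_support_pure_iff _ _).1 hb
    rw [this, hv, htail, hs]
    rfl
  -- Passing to the executions through `w₀` costs at most the constant factor `(adv.worlds s K
  -- w₀)⁻¹`, which does not spoil a limit `0`. This is where almost sure termination is
  -- indispensable.
  have hlim : ∀ E : World P → Prop,
      Tendsto (fun k => adv.prob s k fun h => E h.1.1) atTop (𝓝 0) →
      Tendsto (fun m => (chain s sched₂ w₀ m).toOuterMeasure {w | E w}) atTop (𝓝 0) := by
    intro E hE
    have h1 : Tendsto (fun m => (adv.worlds s K w₀)⁻¹ * adv.prob s (m + K) fun h => E h.1.1)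
        atTop (𝓝 0) := by
      have := ENNReal.Tendsto.const_mul (a := (adv.worlds s K w₀)⁻¹)
        ((tendsto_add_atTop_iff_nat K).2 hE) (.inr (ENNReal.inv_ne_top.2 hp0))
      simpa using this
    refine tendsto_of_tendsto_of_tendsto_of_le_of_le tendsto_const_nhds h1 (fun _ => zero_le) ?_
    intro m
    have hne : adv.worlds s K w₀ ≠ ⊤ := PMF.apply_ne_top _ _
    simp only
    rw [Adversary.prob_world, add_comm m K,
      worlds_ofSched_add htail (fun m => (h₂.mem m).1) s m]
    calc (chain s sched₂ w₀ m).toOuterMeasure {w | E w}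
        = (adv.worlds s K w₀)⁻¹ *
          (adv.worlds s K w₀ * (chain s sched₂ w₀ m).toOuterMeasure {w | E w}) := by
          rw [← mul_assoc, ENNReal.inv_mul_cancel hp0 hne, one_mul]
      _ ≤ _ := by
          gcongr
          exact mul_outer_le_bind (adv.worlds s K) (fun w => chain s sched₂ w m) w₀ _
  have hcomp : ∀ j ∉ D, Tendsto (fun m => (chain s sched₂ w₀ m).toOuterMeasure
      {w | w.completedS j}ᶜ) atTop (𝓝 0) := by
    intro j hj
    have h1 := hlim (fun w => ((∃ i ∉ D, w.completedS i) ∧ w.participates j) ∧ ¬ w.completedS j)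
      (hP.termination_all adv hcard hfair s j hj)
    obtain ⟨N, -, hN⟩ := h₂.often (.startS j) ⟨hj, by rintro _ _ _ ⟨⟩⟩ 0
    have ha0 : ∀ m, (chain s sched₂ w₀ m).toOuterMeasure {w | w.completedS a}ᶜ = 0 := by
      intro m
      have := chain_antitone (s := s) (sched := sched₂) (w₀ := w₀) (A := {w | w.completedS a})
        (fun w hw _ _ h => completedS_of_hstep h hw) (Nat.zero_le m)
      refine le_antisymm (this.trans ?_) zero_le
      have hmem : w₀ ∈ {w : World P | w.completedS a} := by
        obtain ⟨l, hl, hls⟩ := has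
        exact ⟨l, by simp [hw₀, assemble, ha, hl], hls⟩
      simp only [chain, nonpos_iff_eq_zero, PMF.toOuterMeasure_apply_eq_zero_iff, PMF.support_pure,
        Set.disjoint_singleton_left]
      exact fun h => h hmem
    refine tendsto_of_tendsto_of_tendsto_of_le_of_le' tendsto_const_nhds h1
      (Eventually.of_forall fun _ => zero_le) ?_
    filter_upwards [eventually_gt_atTop N] with m hm
    calc (chain s sched₂ w₀ m).toOuterMeasure {w | w.completedS j}ᶜ
        ≤ (chain s sched₂ w₀ m).toOuterMeasure
          ({w | ((∃ i ∉ D, w.completedS i) ∧ w.participates j) ∧ ¬ w.completedS j} ∪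
            ({w | w.completedS a}ᶜ ∪ {w | w.participates j}ᶜ)) := by
          refine MeasureTheory.measure_mono fun w hw => ?_
          by_cases h1 : w.completedS a
          · by_cases h2 : w.participates j
            · exact .inl ⟨⟨⟨a, ha, h1⟩, h2⟩, hw⟩
            · exact .inr (.inr h2)
          · exact .inr (.inl h1)
      _ ≤ _ := by
          refine (MeasureTheory.measure_union_le _ _).trans ?_
          refine (add_le_add_right (MeasureTheory.measure_union_le _ _) _).trans ?_
          rw [ha0 m, chain_participates hN hm]
          simp
  have hbeg : ∀ j ∉ D, Tendsto (fun m => (chain s sched₂ w₀ m).toOuterMeasure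
      {w | w.begunR j}ᶜ) atTop (𝓝 0) := fun j hj =>
    chain_begunR (h₂.often (.startR j) ⟨hj, by rintro _ _ _ ⟨⟩⟩) (hcomp j hj)
  have hout := hlim (fun w => (∀ i ∉ D, w.completedS i ∧ w.begunR i) ∧
    ¬ ∀ i ∉ D, ∃ v, w.outputs i v) (hP.termination_reconstruct adv hcard hfair s)
  -- If `c` has not finished, then either the clause on reconstruction fails or its premise does not
  -- hold yet at some party.
  have hsum : Tendsto (fun m => (chain s sched₂ w₀ m).toOuterMeasure
      {w | (∀ i ∉ D, w.completedS i ∧ w.begunR i) ∧ ¬ ∀ i ∉ D, ∃ v, w.outputs i v} +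
      ∑ j ∈ Dᶜ, ((chain s sched₂ w₀ m).toOuterMeasure {w | w.completedS j}ᶜ +
        (chain s sched₂ w₀ m).toOuterMeasure {w | w.begunR j}ᶜ)) atTop (𝓝 0) := by
    have : Tendsto (fun m => ∑ j ∈ Dᶜ, ((chain s sched₂ w₀ m).toOuterMeasure
        {w | w.completedS j}ᶜ + (chain s sched₂ w₀ m).toOuterMeasure {w | w.begunR j}ᶜ))
        atTop (𝓝 (∑ j ∈ Dᶜ, (0 + 0))) :=
      tendsto_finsetSum _ fun j hj =>
        (hcomp j (Finset.mem_compl.1 hj)).add (hbeg j (Finset.mem_compl.1 hj))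
    simpa using hout.add this
  refine tendsto_of_tendsto_of_tendsto_of_le_of_le tendsto_const_nhds hsum (fun _ => zero_le) ?_
  intro m
  calc (chain s sched₂ w₀ m).toOuterMeasure {w | w.completedS c ∧ ∃ v, w.outputs c v}ᶜ
      ≤ (chain s sched₂ w₀ m).toOuterMeasure
        ({w | (∀ i ∉ D, w.completedS i ∧ w.begunR i) ∧ ¬ ∀ i ∉ D, ∃ v, w.outputs i v} ∪
          ⋃ j ∈ Dᶜ, ({w | w.completedS j}ᶜ ∪ {w | w.begunR j}ᶜ)) := by
        refine MeasureTheory.measure_mono fun w hw => ?_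
        by_cases h1 : ∀ i ∉ D, w.completedS i ∧ w.begunR i
        · exact .inl ⟨h1, fun h2 => hw ⟨(h1 c hcD).1, h2 c hcD⟩⟩
        · right
          push Not at h1
          obtain ⟨i, hi, h1⟩ := h1
          simp only [Set.mem_iUnion]
          refine ⟨i, Finset.mem_compl.2 hi, ?_⟩
          by_cases h2 : w.completedS i
          · exact .inr (h1 h2)
          · exact .inl h2
    _ ≤ _ := by
        refine (MeasureTheory.measure_union_le _ _).trans (add_le_add_right ?_ _)
        refine (MeasureTheory.measure_biUnion_finset_le _ _).trans ?_
        exact Finset.sum_le_sum fun j _ => MeasureTheory.measure_union_le _ _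

/-! ### The adversary that replaces its memory -/

/-- The world with the data of `X` taken from `u` and the rest from `w`. -/
def glue (X : Finset (Fin n)) (w u : World P) : World P where
  loc j := if j ∈ X then u.loc j else w.loc j
  sent i j := if i ∈ X then u.sent i j else w.sent i j
  delivered i j := if i ∈ X ∨ j ∈ X then u.delivered i j else w.delivered i j

open Classical in
/-- The adversary who controls `X` replaces the data of the parties in `X` by those in `u`. -/
def Sim.resample (X : Finset (Fin n)) (v : Sim P) (u : World P) : Sim P where
  world :=
    { loc := fun j => if j ∈ X then u.loc j else none
      -- Messages from outside have really been sent and are kept; only the past of `X` itself is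
      -- rewritten.
      sent := fun i j => if i ∈ X then u.sent i j else v.world.sent i j
      delivered := fun i j => if i ∈ X ∨ j ∈ X then u.delivered i j else ∅ }
  part j := if j ∈ X then u.participates j else v.part j

/-- Together with `mask_glue`, this shows that the adversary can bring about the glued world: only
its simulation changes, and nothing outside `X` does. -/
theorem sim_glue (X : Finset (Fin n)) (w u : World P) :
    (glue X w u).sim X = (w.sim X).resample X u := by
  refine Sim.ext (World.ext' (fun j => ?_) (fun i j => ?_) (fun i j => ?_)) (funext fun j => ?_)
  · by_cases h : j ∈ X <;> simp [glue, World.sim, Sim.resample, h]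
  · by_cases h : i ∈ X <;> simp [glue, World.sim, Sim.resample, h]
  · by_cases h : i ∈ X ∨ j ∈ X <;> simp [glue, World.sim, Sim.resample, h]
  · by_cases h : j ∈ X <;> simp [glue, World.sim, Sim.resample, World.participates, h]

theorem mask_glue (X : Finset (Fin n)) (w u : World P) : (glue X w u).mask X = w.mask X := by
  refine World.ext' (fun j => ?_) (fun i j => ?_) (fun i j => ?_)
  · by_cases h : j ∈ X <;> simp [glue, World.mask, h]
  · by_cases h : i ∈ X <;> simp [glue, World.mask, h]
  · by_cases h : i ∈ X ∨ j ∈ X <;> simp [glue, World.mask, h]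

/-- The states of the imitation recorded in a view. -/
def simStates (view : List (Entry P (Sim P))) : List (Sim P) := view.map fun e => e.1.absorb e.2.2

/-- The strategy of `simAdv`. -/
noncomputable def simNext (X : Finset (Fin n)) (s₀ : F) (K M : ℕ)
    (sched₁ sched₂ sched₃ : ℕ → Move n) (R : List (Sim P) → PMF (World P))
    (view : List (Entry P (Sim P))) : PMF (Sim P × Action P) :=
  if view.length < K then
    simMove X s₀ (sched₁ view.length) ((simStates view).getLastD ((World.init P).sim X))
  else if view.length = K then (R (simStates view)).bind fun u =>
    simMove X s₀ (sched₂ 0) (((simStates view).getLastD ((World.init P).sim X)).resample X u)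
  else if view.length < K + M then
    simMove X s₀ (sched₂ (view.length - K))
      ((simStates view).getLastD ((World.init P).sim X))
  -- This last stage only makes the scheduling valid, by finally delivering what was held back. Its
  -- offset is immaterial, as every move recurs.
  else PMF.pure ((simStates view).getLastD ((World.init P).sim X), (sched₃ view.length).toAction)

/-- The adversary who controls `X` and runs the code of the parties in `X` for `K` steps of an
honest execution, then replaces their data by those in a world drawn from `R`, runs their code for
`M` more steps and stops, after which the schedule is `sched₃`. -/
noncomputable abbrev simAdv (X : Finset (Fin n)) (s₀ : F) (K M : ℕ)
    (sched₁ sched₂ sched₃ : ℕ → Move n) (R : List (Sim P) → PMF (World P)) : Adversary P :=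
  ⟨X, Sim P, simNext X s₀ K M sched₁ sched₂ sched₃ R⟩

theorem step_map_simStates (X : Finset (Fin n)) (next : List (Entry P (Sim P)) →
    PMF (Sim P × Action P)) (s : F) (c : World P × List (Entry P (Sim P))) :
    ((⟨X, Sim P, next⟩ : Adversary P).step s c).map (fun c => (c.1, simStates c.2)) =
      (next c.2).bind fun p => ((⟨X, Sim P, next⟩ : Adversary P).effect s c.1 p.2).map fun x =>
        (x.1, simStates c.2 ++ [p.1.absorb x.2]) := by
  rw [Adversary.step, PMF.map_bind]
  simp only [PMF.map_comp, Function.comp_def, simStates, List.map_append, List.map_cons,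
    List.map_nil]

theorem getLastD_map {α β : Type*} (f : α → β) (l : List α) (a : α) :
    (l.map f).getLastD (f a) = f (l.getLastD a) := by
  induction l using List.reverseRecOn with
  | nil => rfl
  | append_singleton l x _ => simp

section

variable {X : Finset (Fin n)} {s₀ : F} {K M : ℕ} {sched₁ sched₂ sched₃ : ℕ → Move n}
  {R : List (Sim P) → PMF (World P)}

/-- Induction with `simMove_bind`. The whole list of simulated states is tracked, because `R` draws
from it at time `K`. -/
theorem simAdv_share (hD : P.dealer ∉ X) (s : F) {k : ℕ} (hk : k ≤ K) :
    (((simAdv X s₀ K M sched₁ sched₂ sched₃ R).run s k).map Prod.fst).map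
        (fun c => (c.1, simStates c.2)) =
      (hist P s sched₁ k).map fun h =>
        ((h.getLastD (World.init P)).mask X, h.map (World.sim X)) := by
  induction k with
  | zero =>
    simp only [Adversary.run, PMF.pure_map, hist, simStates, List.map_nil, List.getLastD_nil]
    congr 2
    refine World.ext' (fun j => ?_) (fun i j => ?_) (fun i j => ?_) <;>
      simp [World.mask, World.init]
  | succ k ih =>
    let f : World P × List (Sim P) → PMF (World P × List (Sim P)) := fun q =>
      (simMove X s₀ (sched₁ k) (q.2.getLastD ((World.init P).sim X))).bind fun p =>
        ((simAdv X s₀ K M sched₁ sched₂ sched₃ R).effect s q.1 p.2).map fun x =>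
          (x.1, q.2 ++ [p.1.absorb x.2])
    have h1 : ∀ c ∈ (((simAdv X s₀ K M sched₁ sched₂ sched₃ R).run s k).map Prod.fst).support,
        ((simAdv X s₀ K M sched₁ sched₂ sched₃ R).step s c).map (fun c => (c.1, simStates c.2)) =
          f (c.1, simStates c.2) := by
      intro c hc
      have hl := Adversary.length_of_mem_run _ s k hc
      rw [step_map_simStates, simNext, if_pos (by omega), hl]
    rw [Adversary.run_map_fst_succ, PMF.map_bind, pmf_bind_congr h1,
      ← Function.comp_def f, ← PMF.bind_map _ _ f, ih (by omega), PMF.bind_map, hist, PMF.map_bind]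
    congr 1
    funext h
    simp only [Function.comp_def, f, getLastD_map]
    have h2 := simMove_bind (simAdv X s₀ K M sched₁ sched₂ sched₃ R) hD s s₀
      (h.getLastD (World.init P)) (sched₁ k)
    have h3 := congrArg (PMF.map fun q : World P × Sim P => (q.1, h.map (World.sim X) ++ [q.2])) h2
    rw [PMF.map_bind, PMF.map_comp] at h3
    simp only [PMF.map_comp, Function.comp_def] at h3
    rw [PMF.map_comp]
    simp only [Function.comp_def, List.getLastD_concat, List.map_append, List.map_cons,
      List.map_nil]
    exact h3

theorem step_map_last (next : List (Entry P (Sim P)) → PMF (Sim P × Action P)) (s : F)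
    (c : World P × List (Entry P (Sim P))) (v : Sim P) :
    ((⟨X, Sim P, next⟩ : Adversary P).step s c).map
      (fun c => (c.1, (simStates c.2).getLastD v)) =
      (next c.2).bind fun p => ((⟨X, Sim P, next⟩ : Adversary P).effect s c.1 p.2).map fun x =>
        (x.1, p.1.absorb x.2) := by
  have h := congrArg (PMF.map fun q : World P × List (Sim P) => (q.1, q.2.getLastD v))
    (step_map_simStates X next s c)
  rw [PMF.map_comp, PMF.map_bind] at h
  simp only [PMF.map_comp, Function.comp_def, List.getLastD_concat] at h
  exact h

/-- The memory is replaced within the same step as the first move of `sched₂`, which is why the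
count starts at `m + 1`. From then on only the latest simulated state matters. -/
theorem simAdv_reconstruct (hD : P.dealer ∉ X) (s : F) {m : ℕ} (hm : m < M) :
    (((simAdv X s₀ K M sched₁ sched₂ sched₃ R).run s (K + (m + 1))).map Prod.fst).map
        (fun c => (c.1, (simStates c.2).getLastD ((World.init P).sim X))) =
      (hist P s sched₁ K).bind fun h => (R (h.map (World.sim X))).bind fun u =>
        (chain s sched₂ (glue X (h.getLastD (World.init P)) u) (m + 1)).map fun w =>
          (w.mask X, w.sim X) := by
  induction m with
  | zero =>
    let f : World P × List (Sim P) → PMF (World P × Sim P) := fun q =>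
      (R q.2).bind fun u =>
      (simMove X s₀ (sched₂ 0) ((q.2.getLastD ((World.init P).sim X)).resample X u)).bind fun p =>
        ((simAdv X s₀ K M sched₁ sched₂ sched₃ R).effect s q.1 p.2).map fun x =>
          (x.1, p.1.absorb x.2)
    have h1 : ∀ c ∈ (((simAdv X s₀ K M sched₁ sched₂ sched₃ R).run s K).map Prod.fst).support,
        ((simAdv X s₀ K M sched₁ sched₂ sched₃ R).step s c).map
          (fun c => (c.1, (simStates c.2).getLastD ((World.init P).sim X))) =
          f (c.1, simStates c.2) := by
      intro c hc
      have hl := Adversary.length_of_mem_run _ s K hc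
      rw [step_map_last, simNext, if_neg (by omega), if_pos hl, PMF.bind_bind]
    rw [← add_assoc, add_zero, Adversary.run_map_fst_succ, PMF.map_bind, pmf_bind_congr h1,
      ← Function.comp_def f, ← PMF.bind_map _ _ f, simAdv_share hD s le_rfl, PMF.bind_map]
    congr 1
    funext h
    simp only [Function.comp_def, f, getLastD_map]
    congr 1
    funext u
    have h2 := simMove_bind (simAdv X s₀ K M sched₁ sched₂ sched₃ R) hD s s₀
      (glue X (h.getLastD (World.init P)) u) (sched₂ 0)
    rw [sim_glue, mask_glue] at h2
    rw [h2]
    simp [chain]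
  | succ m ih =>
    let f : World P × Sim P → PMF (World P × Sim P) := fun q =>
      (simMove X s₀ (sched₂ (m + 1)) q.2).bind fun p =>
        ((simAdv X s₀ K M sched₁ sched₂ sched₃ R).effect s q.1 p.2).map fun x =>
          (x.1, p.1.absorb x.2)
    have h1 : ∀ c ∈ (((simAdv X s₀ K M sched₁ sched₂ sched₃ R).run s
          (K + (m + 1))).map Prod.fst).support,
        ((simAdv X s₀ K M sched₁ sched₂ sched₃ R).step s c).map
          (fun c => (c.1, (simStates c.2).getLastD ((World.init P).sim X))) =
          f (c.1, (simStates c.2).getLastD ((World.init P).sim X)) := by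
      intro c hc
      have hl := Adversary.length_of_mem_run _ s _ hc
      rw [step_map_last, simNext, if_neg (by omega), if_neg (by omega), if_pos (by omega), hl,
        Nat.add_sub_cancel_left]
    rw [← add_assoc, Adversary.run_map_fst_succ, PMF.map_bind, pmf_bind_congr h1,
      ← Function.comp_def f, ← PMF.bind_map _ _ f, ih (by omega), PMF.bind_bind]
    congr 1
    funext h
    rw [PMF.bind_bind]
    congr 1
    funext u
    rw [PMF.bind_map]
    conv_rhs => rw [chain, PMF.map_bind]
    congr 1
    funext w
    exact simMove_bind (simAdv X s₀ K M sched₁ sched₂ sched₃ R) hD s s₀ w (sched₂ (m + 1))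

theorem simAdv_fair (h₃ : Covers (movesOff ∅) sched₃) :
    (simAdv X s₀ K M sched₁ sched₂ sched₃ R).Fair := by
  refine fair_of_deliver fun i _ j _ k N => ?_
  obtain ⟨τ, hτ, hs⟩ := h₃.often (.deliver i j k)
    ⟨Finset.notMem_empty _, fun _ _ _ _ => Finset.notMem_empty _⟩ (N + K + M + 1)
  refine ⟨τ, by omega, fun v hv b hb => ?_⟩
  simp only [simNext] at hb
  rw [if_neg (by omega), if_neg (by omega), if_neg (by omega)] at hb
  rw [(PMF.mem_support_pure_iff _ _).1 hb, hv, hs]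
  rfl

theorem isStartR_simMove {m : Move n} (hm : ∀ j, m ≠ .startR j) {v : Sim P} {p : Sim P × Action P}
    (hp : p ∈ (simMove X s₀ m v).support) : p.2.isStartR = false := by
  have ht : (m.toAction : Action P).isStartR = false := by
    rcases m with a | a | ⟨a, b, k⟩
    · rfl
    · exact absurd rfl (hm a)
    · rfl
  unfold simMove at hp
  split at hp
  · simp only [PMF.support_map, Set.mem_image] at hp
    obtain ⟨y, -, rfl⟩ := hp
    exact ht
  · split at hp
    · split at hp
      · split at hp
        · rw [(PMF.mem_support_pure_iff _ _).1 hp]; rfl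
        · rw [(PMF.mem_support_pure_iff _ _).1 hp]; rfl
      · rw [(PMF.mem_support_pure_iff _ _).1 hp]; rfl
    · rw [(PMF.mem_support_pure_iff _ _).1 hp]; exact ht

theorem simAdv_shareView (hs : ∀ k j, sched₁ k ≠ .startR j) (s : F) {k : ℕ} (hk : k ≤ K)
    {c : (simAdv X s₀ K M sched₁ sched₂ sched₃ R).Config}
    (hc : c ∈ (((simAdv X s₀ K M sched₁ sched₂ sched₃ R).run s k).map Prod.fst).support) :
    ∀ e ∈ c.2, e.2.1.isStartR = false := by
  induction k generalizing c with
  | zero => simp [Adversary.run, PMF.pure_map] at hc; simp [hc]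
  | succ k ih =>
    rw [Adversary.run_map_fst_succ, PMF.mem_support_bind_iff] at hc
    obtain ⟨b, hb, hc⟩ := hc
    obtain ⟨a, ha, x, -, rfl⟩ := mem_support_step hc
    have hl := Adversary.length_of_mem_run _ s k hb
    intro e he
    rcases List.mem_append.1 he with he | he
    · exact ih (by omega) hb e he
    · rw [List.mem_singleton] at he
      subst he
      simp only [simNext] at ha
      rw [if_pos (by omega)] at ha
      exact isStartR_simMove (hs _) ha

/-- By secrecy, what a small set `X` of parties sees in an honest execution of the sharing phase
does not depend on the secret. -/
theorem hist_map_sim_eq {t : ℕ} {δ : ℝ} (hP : P.IsAVSS t δ) (hX : X.card ≤ t)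
    (hD : P.dealer ∉ X) (hs : ∀ k j, sched₁ k ≠ .startR j) (s s' : F) (K : ℕ) :
    (hist P s sched₁ K).map (fun h => h.map (World.sim X)) =
      (hist P s' sched₁ K).map (fun h => h.map (World.sim X)) := by
  obtain ⟨sched₃, h₃⟩ := exists_covers (G := movesOff (∅ : Finset (Fin n)))
    ⟨.startS P.dealer, Finset.notMem_empty _, fun _ _ _ _ => Finset.notMem_empty _⟩
  let R : List (Sim P) → PMF (World P) := fun _ => PMF.pure (World.init P)
  -- A single adversary must serve both secrets; the `s` in `simAdv X s` is an arbitrary constant.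
  -- `R` and the stages after `K` are never reached.
  have key : ∀ s₁, (hist P s₁ sched₁ K).map (fun h => h.map (World.sim X)) =
      (((simAdv X s K 0 sched₁ sched₁ sched₃ R).run s₁ K).map fun h =>
        (simAdv X s K 0 sched₁ sched₁ sched₃ R).shareView h.1).map simStates := by
    intro s₁
    calc (hist P s₁ sched₁ K).map (fun h => h.map (World.sim X))
        = ((hist P s₁ sched₁ K).map fun h =>
            ((h.getLastD (World.init P)).mask X, h.map (World.sim X))).map Prod.snd := by
          rw [PMF.map_comp]; rfl
      _ = (((simAdv X s K 0 sched₁ sched₁ sched₃ R).run s₁ K).map Prod.fst).map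
            (fun c => simStates c.2) := by
          rw [← simAdv_share (s₀ := s) (M := 0) (sched₂ := sched₁) (sched₃ := sched₃) (R := R)
            hD s₁ le_rfl, PMF.map_comp]
          rfl
      _ = (((simAdv X s K 0 sched₁ sched₁ sched₃ R).run s₁ K).map Prod.fst).map
            (fun c => simStates ((simAdv X s K 0 sched₁ sched₁ sched₃ R).shareView c)) := by
          -- No call of `R` occurs in the first `K` steps, so the view covered by secrecy is the
          -- entire view.
          refine pmf_map_congr fun c hc => congrArg simStates (Eq.symm ?_)
          refine List.takeWhile_eq_self_iff.2 fun e he => ?_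
          rw [simAdv_shareView hs s₁ le_rfl hc e he]
          rfl
      _ = _ := by
          rw [PMF.map_comp, PMF.map_comp]; rfl
  rw [key, key, hP.secrecy (simAdv X s K 0 sched₁ sched₁ sched₃ R) hX (simAdv_fair h₃) hD s s' K]

end

/-- Such a move reads no record of `D` and no channel from `D`, and only the dealer, who is in `D`,
reads the secret. So `D` can be deleted and the secret changed. -/
theorem hstep_mask {D : Finset (Fin n)} (hD : P.dealer ∈ D) {m : Move n} (hm : m ∈ movesOff D)
    (s s₁ : F) (w : World P) :
    (hstep s w m).map (World.mask D) = hstep s₁ (w.mask D) m := by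
  have hr : (w.mask D).resp s₁ m = w.resp s m := by
    refine World.resp_congr ?_ ?_ fun h => absurd (h ▸ hD) hm.1
    · simp [World.mask, hm.1]
    · rintro i j k rfl
      have h1 := hm.2 i j k rfl
      have h2 : j ∉ D := hm.1
      simp [World.mask, h1, h2]
  rw [hstep, hstep, hr]
  cases w.resp s m with
  | none => simp [PMF.pure_map]
  | some p =>
    simp only [PMF.map_comp, Function.comp_def]
    congr 1
    funext x
    exact World.mask_fire_of_notMem w hm.1 hm.2 _ _

theorem chain_mask {D : Finset (Fin n)} (hD : P.dealer ∈ D) {sched : ℕ → Move n}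
    (hs : ∀ k, sched k ∈ movesOff D) (s s₁ : F) (w : World P) (k : ℕ) :
    (chain s sched w k).map (World.mask D) = chain s₁ sched (w.mask D) k := by
  induction k with
  | zero => simp [chain, PMF.pure_map]
  | succ k ih =>
    rw [chain, chain, ← ih, PMF.map_bind, PMF.bind_map]
    congr 1
    funext u
    exact hstep_mask hD (hs k) s s₁ u

/-- The law of the record of an honest party in the second part of the execution with `simAdv`. -/
theorem simAdv_loc {X D : Finset (Fin n)} {s₀ : F} {K M : ℕ} {sched₁ sched₂ sched₃ : ℕ → Move n}
    {R : List (Sim P) → PMF (World P)} (hX : P.dealer ∉ X) (hD : P.dealer ∈ D)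
    (hs : ∀ k, sched₂ k ∈ movesOff D) {c : Fin n} (hcX : c ∉ X) (hcD : c ∉ D) (hM : 0 < M)
    (s s₁ : F) :
    ((simAdv X s₀ K M sched₁ sched₂ sched₃ R).worlds s (K + M)).map (fun w => w.loc c) =
      ((hist P s sched₁ K).bind fun h => (R (h.map (World.sim X))).map fun u =>
        (glue X (h.getLastD (World.init P)) u).mask D).bind fun w =>
          (chain s₁ sched₂ w M).map fun w => w.loc c := by
  obtain ⟨m, rfl⟩ : ∃ m, M = m + 1 := ⟨M - 1, by omega⟩
  have h := congrArg (PMF.map fun q : World P × Sim P => q.1.loc c)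
    (simAdv_reconstruct (s₀ := s₀) (K := K) (sched₁ := sched₁) (sched₂ := sched₂)
      (sched₃ := sched₃) (R := R) hX s (Nat.lt_succ_self m))
  rw [PMF.map_comp, PMF.map_comp] at h
  refine Eq.trans (Eq.trans ?_ h) ?_
  · rw [Adversary.worlds, PMF.map_comp]
    rfl
  · rw [PMF.map_bind, PMF.bind_bind]
    congr 1
    funext l
    rw [PMF.map_bind, PMF.bind_map]
    congr 1
    funext u
    rw [Function.comp_def]
    simp only
    rw [← chain_mask hD hs s s₁, PMF.map_comp, PMF.map_comp]
    congr 1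
    funext w
    simp [World.mask, hcX, hcD]

/-! ### The contradiction from a common law of outputs -/

/-- The party has completed both phases. -/
def Finished (o : Option (Local P)) : Prop :=
  ∃ l, o = some l ∧ l.shared = true ∧ ∃ v, l.output = some v

/-- The party has completed the reconstruction with output `v`. -/
def Returned (v : F) (o : Option (Local P)) : Prop := ∃ l, o = some l ∧ l.output = some v

/-- If `c` has finished both phases, some nonfaulty party has completed `S`, so the event of
correctness forces the output of `c` to be the secret. -/
theorem le_of_correctness {t : ℕ} {δ : ℝ} (hP : P.IsAVSS t δ) (adv : Adversary P)
    (hcard : adv.corrupt.card ≤ t) (hfair : adv.Fair) (hD : P.dealer ∉ adv.corrupt) {c : Fin n}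
    (hc : c ∉ adv.corrupt) (s : F) (k : ℕ) :
    ENNReal.ofReal δ ≤ ((adv.worlds s k).map fun w => w.loc c).toOuterMeasure {o | ¬ Finished o} +
      ((adv.worlds s k).map fun w => w.loc c).toOuterMeasure {o | Returned s o} := by
  obtain ⟨r, hr⟩ := hP.correctness adv hcard hfair s
  refine (hr k).trans ?_
  rw [Adversary.worlds, PMF.map_comp, PMF.toOuterMeasure_map_apply, PMF.toOuterMeasure_map_apply]
  refine le_trans (MeasureTheory.measure_mono fun h hh => ?_) (MeasureTheory.measure_union_le _ _)
  by_cases hf : Finished (h.1.1.loc c)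
  · right
    obtain ⟨l, hl, hls, v, hv⟩ := hf
    obtain ⟨d, hd⟩ : ∃ d, adv.firstCompletion h = some d := by
      rw [Adversary.firstCompletion, ← Option.isSome_iff_exists, List.find?_isSome]
      have hex : ∃ i ∉ adv.corrupt, h.1.1.completedS i := ⟨c, hc, l, hl, hls⟩
      exact ⟨h.1, by simp, by simpa only [decide_eq_true_eq] using hex⟩
    obtain ⟨h1, h2⟩ := hh d hd
    have := h2 c hc v ⟨l, hl, hv⟩
    rw [h1 hD] at this
    exact ⟨l, hl, this ▸ hv⟩
  · exact .inl hf

/-- Dominated convergence, with `p` itself as summable bound. It is needed because the speed of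
termination depends on the starting world. -/
theorem tendsto_tsum_mul {α : Type*} (p : PMF α) {f : ℕ → α → ENNReal} (hf : ∀ m a, f m a ≤ 1)
    (h : ∀ a ∈ p.support, Tendsto (fun m => f m a) atTop (𝓝 0)) :
    Tendsto (fun m => ∑' a, p a * f m a) atTop (𝓝 0) := by
  let : MeasurableSpace α := ⊤
  have := MeasureTheory.tendsto_lintegral_of_dominated_convergence
    (μ := MeasureTheory.Measure.count) (F := fun m a => p a * f m a) (f := fun _ => 0) p
    (fun m => measurable_from_top)
    (fun m => Eventually.of_forall fun a => mul_le_of_le_one_right' (hf m a))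
    (by rw [MeasureTheory.lintegral_count, p.tsum_coe]; simp)
    (Eventually.of_forall fun a => by
      by_cases ha : a ∈ p.support
      · simpa using ENNReal.Tendsto.const_mul (h a ha) (.inr (PMF.apply_ne_top p a))
      · rw [PMF.mem_support_iff, not_not] at ha
        simp [ha])
  simpa [MeasureTheory.lintegral_count] using this

/-- The record of one party cannot have the same law in executions with different secrets. -/
theorem not_isAVSS_of_common_law {t : ℕ} {ε : ℝ} (hε : 0 < ε) (hP : P.IsAVSS t (1 / 2 + ε))
    {sched₂ : ℕ → Move n} {start : PMF (World P)} {a c : Fin n} {s s' s₁ : F} (hs : s ≠ s')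
    (hterm : ∀ w ∈ start.support, w.completedS a → Tendsto (fun m =>
      (chain s₁ sched₂ w m).toOuterMeasure {w | w.completedS c ∧ ∃ v, w.outputs c v}ᶜ)
        atTop (𝓝 0))
    (hstart : start.toOuterMeasure {w | w.completedS a}ᶜ < ENNReal.ofReal (ε / 2))
    (hadv : ∀ s₂, s₂ = s ∨ s₂ = s' → ∀ M, 0 < M → ∃ (adv : Adversary P) (k : ℕ),
      adv.corrupt.card ≤ t ∧ adv.Fair ∧ P.dealer ∉ adv.corrupt ∧ c ∉ adv.corrupt ∧
      (adv.worlds s₂ k).map (fun w => w.loc c) =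
        start.bind fun w => (chain s₁ sched₂ w M).map fun w => w.loc c) : False := by
  classical
  let q : ℕ → World P → ENNReal := fun m w =>
    (chain s₁ sched₂ w m).toOuterMeasure {w | w.completedS c ∧ ∃ v, w.outputs c v}ᶜ
  have h1 := tendsto_tsum_mul start (f := fun m w => if w.completedS a then q m w else 0)
    (fun m w => by
      split_ifs
      · exact pmf_outer_le_one _ _
      · exact zero_le)
    (fun w hw => by
      by_cases h : w.completedS a
      · simpa [h] using hterm w hw h
      · simp [h])
  have hε2 : (0 : ENNReal) < ENNReal.ofReal (ε / 2) := ENNReal.ofReal_pos.2 (by linarith)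
  -- `M` depends only on the common start law, so it can be fixed before the adversaries. Slow
  -- termination and a late `a` each cost less than `ε / 2`.
  obtain ⟨M, hM, hM0⟩ := ((h1.eventually (gt_mem_nhds hε2)).and (eventually_gt_atTop 0)).exists
  set ρ := start.bind fun w => (chain s₁ sched₂ w M).map fun w => w.loc c with hρ
  have hbad : ρ.toOuterMeasure {o | ¬ Finished o} < ENNReal.ofReal ε := by
    calc ρ.toOuterMeasure {o | ¬ Finished o} ≤ (∑' w, start w *
          (if w.completedS a then q M w else 0)) + start.toOuterMeasure {w | w.completedS a}ᶜ := by
          rw [hρ, PMF.toOuterMeasure_bind_apply, PMF.toOuterMeasure_apply, ← ENNReal.tsum_add]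
          refine ENNReal.tsum_le_tsum fun w => ?_
          by_cases h : w.completedS a
          · rw [if_pos h]
            refine le_trans ?_ le_self_add
            gcongr
            rw [PMF.toOuterMeasure_map_apply]
            refine MeasureTheory.measure_mono fun u hu hu' => hu ?_
            obtain ⟨⟨l, hl, hls⟩, v, l', hl', hv⟩ := hu'
            rw [hl, Option.some.injEq] at hl'
            exact ⟨l, hl, hls, v, hl' ▸ hv⟩
          · rw [if_neg h, mul_zero, zero_add, Set.indicator_of_mem (by exact h)]
            exact mul_le_of_le_one_right' (pmf_outer_le_one _ _)
      _ < ENNReal.ofReal (ε / 2) + ENNReal.ofReal (ε / 2) := ENNReal.add_lt_add hM hstart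
      _ = ENNReal.ofReal ε := by
          rw [← ENNReal.ofReal_add (by linarith) (by linarith)]
          congr 1
          ring
  -- Of the guaranteed `1 / 2 + ε`, less than `ε` is lost to executions in which `c` has not
  -- finished.
  have hret : ∀ s₂, s₂ = s ∨ s₂ = s' → ENNReal.ofReal (1 / 2) <
      ρ.toOuterMeasure {o | Returned s₂ o} := by
    intro s₂ hs₂
    obtain ⟨adv, k, hcard, hfair, hD, hc, hlaw⟩ := hadv s₂ hs₂ M hM0
    have h2 := le_of_correctness hP adv hcard hfair hD hc s₂ k
    rw [hlaw] at h2
    by_contra! h3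
    have h4 := h2.trans_lt (ENNReal.add_lt_add_of_lt_of_le
      (ne_top_of_le_ne_top ENNReal.ofReal_ne_top h3) hbad h3)
    rw [← ENNReal.ofReal_add hε.le (by norm_num), add_comm ε] at h4
    exact lt_irrefl _ h4
  have hdisj : Disjoint {o : Option (Local P) | Returned s o} {o | Returned s' o} := by
    rw [Set.disjoint_left]
    rintro o ⟨l, hl, hv⟩ ⟨l', hl', hv'⟩
    rw [hl, Option.some.injEq] at hl'
    subst hl'
    rw [hv, Option.some.injEq] at hv'
    exact hs hv'
  have hsum : ρ.toOuterMeasure {o | Returned s o} + ρ.toOuterMeasure {o | Returned s' o} ≤ 1 := by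
    rw [PMF.toOuterMeasure_apply, PMF.toOuterMeasure_apply, ← ENNReal.tsum_add]
    refine le_trans (le_of_eq ?_) (pmf_outer_le_one ρ
      ({o | Returned s o} ∪ {o | Returned s' o}))
    rw [PMF.toOuterMeasure_apply, Set.indicator_union_of_disjoint hdisj]
  have := (ENNReal.add_lt_add (hret s (.inl rfl)) (hret s' (.inr rfl))).trans_le hsum
  rw [← ENNReal.ofReal_add (by norm_num) (by norm_num)] at this
  norm_num at this

/-! ### Sample paths and completion of the sharing phase -/

/-- The world after `τ` steps of the history `h`. -/
def path (h : List (World P)) (τ : ℕ) : World P := (h.take τ).getLastD (World.init P)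

theorem path_zero (h : List (World P)) : path h 0 = World.init P := rfl

theorem path_of_map_eq {β : Type*} (f : World P → β) {h h' : List (World P)}
    (hh : h.map f = h'.map f) (τ : ℕ) : f (path h τ) = f (path h' τ) := by
  rw [path, path, ← getLastD_map f, ← getLastD_map f, List.map_take, List.map_take, hh]

section Hist

variable {s : F} {sched : ℕ → Move n} {K : ℕ} {h : List (World P)}

theorem length_of_mem_hist (hh : h ∈ (hist P s sched K).support) : h.length = K := by
  induction K generalizing h with
  | zero => simp [hist] at hh; simp [hh]
  | succ k ih =>
    simp only [hist, PMF.mem_support_bind_iff, PMF.support_map, Set.mem_image] at hh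
    obtain ⟨g, hg, w, -, rfl⟩ := hh
    simp [ih hg]

theorem path_last (hh : h ∈ (hist P s sched K).support) :
    path h K = h.getLastD (World.init P) := by
  rw [path, List.take_of_length_le (length_of_mem_hist hh).le]

theorem path_step (hh : h ∈ (hist P s sched K).support) {τ : ℕ} (hτ : τ < K) :
    path h (τ + 1) ∈ (hstep s (path h τ) (sched τ)).support := by
  induction K generalizing h with
  | zero => omega
  | succ k ih =>
    simp only [hist, PMF.mem_support_bind_iff, PMF.support_map, Set.mem_image] at hh
    obtain ⟨g, hg, w, hw, rfl⟩ := hh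
    have hl := length_of_mem_hist hg
    rcases Nat.lt_succ_iff_lt_or_eq.1 hτ with hlt | rfl
    · have := ih hg hlt
      rwa [path, path, List.take_append_of_le_length (by omega),
        List.take_append_of_le_length (by omega)]
    · rw [path, path, List.take_append_of_le_length (by omega),
        List.take_of_length_le (l := g ++ [w]) (by simp [hl]), List.take_of_length_le hl.le,
        List.getLastD_concat]
      exact hw

/-- A step changes records, outgoing messages and deliveries of its target only. Hence any two
histories agree on the data of the sleeping set `C`, whatever the secrets. -/
theorem path_untouched {C : Finset (Fin n)} (hs : ∀ k, (sched k).target ∉ C)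
    (hh : h ∈ (hist P s sched K).support) {c : Fin n} (hc : c ∈ C) {τ : ℕ} (hτ : τ ≤ K) :
    (path h τ).loc c = none ∧ (∀ j, (path h τ).sent c j = []) ∧
      ∀ i, (path h τ).delivered i c = ∅ := by
  induction τ with
  | zero => simp [path_zero, World.init]
  | succ τ ih =>
    have hstep := path_step hh (show τ < K by omega)
    have hne : c ≠ (sched τ).target := fun h => hs τ (h ▸ hc)
    obtain ⟨h1, h2, h3⟩ := ih (by omega)
    exact ⟨by rw [loc_of_hstep hstep hne, h1], fun j => by rw [sent_of_hstep hstep hne, h2],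
      fun i => by rw [delivered_of_hstep hstep hne, h3]⟩

end Hist

/-- Without faults other than the silence of `C`, the sharing phase is completed. -/
theorem chain_share {t : ℕ} {δ : ℝ} (hP : P.IsAVSS t δ) {C : Finset (Fin n)} (hC : C.card ≤ t)
    (hD : P.dealer ∉ C) {sched : ℕ → Move n} (hs : Covers (shareMovesOff C) sched)
    {a : Fin n} (ha : a ∉ C) (s : F) :
    Tendsto (fun k => (chain s sched (World.init P) k).toOuterMeasure {w | w.completedS a}ᶜ)
      atTop (𝓝 0) := by
  -- The sleeping set is regarded as faulty and mute, so the schedule is valid although `C` is never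
  -- served.
  let adv : Adversary P := Adversary.ofSched C fun k => (sched k).toAction
  have hfair : adv.Fair := by
    refine fair_of_deliver fun i hi j hj k N => ?_
    obtain ⟨τ, hτ, h⟩ := hs.often (.deliver i j k)
      ⟨⟨hj, by rintro _ _ _ ⟨⟩; exact hi⟩, by rintro _ ⟨⟩⟩ N
    refine ⟨τ, hτ, fun v hv b hb => ?_⟩
    have : b = (⟨⟩, (sched v.length).toAction) := (PMF.mem_support_pure_iff _ _).1 hb
    rw [this, hv, h]
    rfl
  have hw : ∀ k, adv.worlds s k = chain s sched (World.init P) k := by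
    intro k
    have := worlds_ofSched_add (D := C) (P := P) (acts := fun k => (sched k).toAction)
      (sched := sched) (K := 0) (fun m => by rw [zero_add]) (fun m => (hs.mem m).1.1) s k
    rw [zero_add, Adversary.worlds_zero, PMF.pure_bind] at this
    exact this
  have h1 := hP.termination_dealer adv hC hfair hD s
  have h2 : ∀ j ∉ C, ∃ N, sched N = .startS j := fun j hj => by
    obtain ⟨N, -, hN⟩ := hs.often (.startS j)
      ⟨⟨hj, by rintro _ _ _ ⟨⟩⟩, by rintro _ ⟨⟩⟩ 0
    exact ⟨N, hN⟩
  have h3 : ∀ᶠ k in atTop, ∀ j ∉ C,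
      (chain s sched (World.init P) k).toOuterMeasure {w | w.participates j}ᶜ = 0 := by
    rw [eventually_all]
    intro j
    by_cases hj : j ∈ C
    · exact Eventually.of_forall fun k h => absurd hj h
    · obtain ⟨N, hN⟩ := h2 j hj
      filter_upwards [eventually_gt_atTop N] with k hk _
      exact chain_participates hN hk
  refine tendsto_of_tendsto_of_tendsto_of_le_of_le' tendsto_const_nhds h1
    (Eventually.of_forall fun _ => zero_le) ?_
  filter_upwards [h3] with k hk
  rw [Adversary.prob_world adv s k fun w => (∀ i ∉ adv.corrupt, w.participates i) ∧
    ¬ ∀ i ∉ adv.corrupt, w.completedS i, hw]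
  calc (chain s sched (World.init P) k).toOuterMeasure {w | w.completedS a}ᶜ
      ≤ (chain s sched (World.init P) k).toOuterMeasure
        ({w | (∀ i ∉ C, w.participates i) ∧ ¬ ∀ i ∉ C, w.completedS i} ∪
          ⋃ j ∈ Cᶜ, {w | w.participates j}ᶜ) := by
        refine MeasureTheory.measure_mono fun w hw => ?_
        by_cases h : ∀ i ∉ C, w.participates i
        · exact .inl ⟨h, fun h' => hw (h' a ha)⟩
        · right
          push Not at h
          obtain ⟨i, hi, h⟩ := h
          simp only [Set.mem_iUnion]
          exact ⟨i, Finset.mem_compl.2 hi, h⟩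
    _ ≤ _ := by
        refine (MeasureTheory.measure_union_le _ _).trans ?_
        refine (add_le_add_right (MeasureTheory.measure_biUnion_finset_le _ _) _).trans ?_
        rw [Finset.sum_eq_zero fun j hj => hk j (Finset.mem_compl.1 hj), add_zero]
        exact le_rfl

/-! ### Conditional laws and the exchange of the order of drawing -/

section Conditional

variable {α β : Type*}

open Classical in
/-- The law `p` under the condition that `T` has the value `b`. -/
noncomputable def condLaw (p : PMF α) (T : α → β) (b : β) : PMF α :=
  -- The default `p` makes the law total; it applies only to values `b` of probability zero.
  if h : ∃ a ∈ {a | T a = b}, a ∈ p.support then p.filter {a | T a = b} h else p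

theorem condLaw_apply (p : PMF α) (T : α → β) {b : β} (hb : b ∈ (p.map T).support) (a : α) :
    condLaw p T b a = {a | T a = b}.indicator p a * ((p.map T) b)⁻¹ := by
  classical
  have h : ∃ a ∈ {a | T a = b}, a ∈ p.support := by
    simp only [PMF.support_map, Set.mem_image] at hb
    obtain ⟨a, ha, rfl⟩ := hb
    exact ⟨a, rfl, ha⟩
  rw [condLaw, dif_pos h, PMF.filter_apply]
  congr 2
  rw [PMF.map_apply]
  refine tsum_congr fun x => ?_
  by_cases hx : T x = b
  · simp [hx]
  · simp [hx, Ne.symm hx]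

/-- If `T` has the same law under `p` and `q`, then it makes no difference which of two values
with a common value of `T` is drawn first. -/
theorem bind_condLaw_comm {p q : PMF α} {T : α → β} (h : p.map T = q.map T) :
    (p.bind fun a => (condLaw q T (T a)).map fun b => (a, b)) =
      q.bind fun b => (condLaw p T (T b)).map fun a => (a, b) := by
  classical
  -- A pair with `T x = T y` has mass `p x * q y` divided by the probability of the common value of
  -- `T`. This is symmetric in the two laws once `T` has the same law under both.
  have e1 : ∀ (p q : PMF α) (x y : α), p.map T = q.map T →
      (∑' a, p a * ((condLaw q T (T a)).map fun b => (a, b)) (x, y)) =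
        if T y = T x then p x * q y * ((p.map T) (T x))⁻¹ else 0 := by
    intro p q x y h
    rw [tsum_eq_single x]
    · by_cases hx : x ∈ p.support
      · have hb : T x ∈ (q.map T).support := by
          rw [← h, PMF.support_map]
          exact ⟨x, hx, rfl⟩
        rw [PMF.map_apply, tsum_eq_single y]
        · rw [if_pos rfl, condLaw_apply q T hb]
          by_cases hxy : T y = T x
          · rw [Set.indicator_of_mem (by exact hxy), if_pos hxy, h, mul_assoc]
          · rw [Set.indicator_of_notMem (by exact hxy), if_neg hxy, zero_mul, mul_zero]
        · intro b hb
          rw [if_neg]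
          simpa using Ne.symm hb
      · rw [PMF.mem_support_iff, not_not] at hx
        simp [hx]
    · intro a ha
      rw [PMF.map_apply]
      simp [Ne.symm ha]
  have e2 : ∀ (b x y : α), ((condLaw p T (T b)).map fun a => (a, b)) (x, y) =
      ((condLaw p T (T b)).map fun a => (b, a)) (y, x) := by
    intro b x y
    rw [PMF.map_apply, PMF.map_apply]
    refine tsum_congr fun a => ?_
    simp only [Prod.mk.injEq, and_comm]
  ext ⟨x, y⟩
  rw [PMF.bind_apply, PMF.bind_apply, e1 p q x y h]
  simp only [e2]
  rw [e1 q p y x h.symm]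
  by_cases hxy : T y = T x
  · rw [if_pos hxy, if_pos hxy.symm, hxy, h, mul_comm (p x)]
  · rw [if_neg hxy, if_neg (Ne.symm hxy)]

theorem mem_support_condLaw {p : PMF α} {T : α → β} {b : β} (hb : b ∈ (p.map T).support) {a : α}
    (ha : a ∈ (condLaw p T b).support) : a ∈ p.support ∧ T a = b := by
  rw [PMF.mem_support_iff, condLaw_apply p T hb] at ha
  have h := left_ne_zero_of_mul ha
  rw [Set.indicator_apply_ne_zero] at h
  exact ⟨h.2, h.1⟩

end Conditional

/-! ### The hybrid argument -/

/-- The communication between `A` and `B`. -/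
def cross (A B : Finset (Fin n)) (u : World P) (i j : Fin n) : List P.Msg × Finset ℕ :=
  if (i ∈ A ∧ j ∈ B) ∨ (i ∈ B ∧ j ∈ A) then (u.sent i j, u.delivered i j) else ([], ∅)

theorem cross_sim {A B X : Finset (Fin n)} (hX : X = A ∨ X = B) (u : World P) :
    cross A B (u.sim X).world = cross A B u := by
  funext i j
  unfold cross
  split_ifs with h
  · rcases hX with rfl | rfl <;> rcases h with h | h <;> simp [World.sim, h]
  · rfl

theorem map_cross_sim {A B X : Finset (Fin n)} (hX : X = A ∨ X = B) (h : List (World P)) :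
    (h.map (World.sim X)).map (fun v => cross A B v.world) = h.map (cross A B) := by
  rw [List.map_map]
  congr 1
  funext u
  exact cross_sim hX u

theorem sent_eq_of_cross {A B : Finset (Fin n)} {u u' : World P} (h : cross A B u = cross A B u')
    {i j : Fin n} (hij : (i ∈ A ∧ j ∈ B) ∨ (i ∈ B ∧ j ∈ A)) :
    u.sent i j = u'.sent i j ∧ u.delivered i j = u'.delivered i j := by
  have := congrFun (congrFun h i) j
  simpa [cross, hij] using this

theorem exists_share_time {t : ℕ} {ε : ℝ} (hε : 0 < ε) {δ : ℝ} (hP : P.IsAVSS t δ)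
    {C : Finset (Fin n)} (hC : C.card ≤ t) (hD : P.dealer ∉ C) {sched : ℕ → Move n}
    (hs : Covers (shareMovesOff C) sched) {a : Fin n} (ha : a ∉ C) (s : F) :
    ∃ K, (hist P s sched K).toOuterMeasure
      {h | (h.getLastD (World.init P)).completedS a}ᶜ < ENNReal.ofReal ε := by
  have h := chain_share hP hC hD hs ha s
  obtain ⟨K, hK⟩ := (h.eventually (gt_mem_nhds (ENNReal.ofReal_pos.2 hε))).exists
  refine ⟨K, ?_⟩
  rw [← hist_map_last, PMF.toOuterMeasure_map_apply] at hK
  exact hK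

theorem startS_mem_shareMovesOff {D : Finset (Fin n)} {j : Fin n} (hj : j ∉ D) :
    .startS j ∈ shareMovesOff D :=
  ⟨⟨hj, by rintro _ _ _ ⟨⟩⟩, by rintro _ ⟨⟩⟩

/-- The lower bound, for a partition of the parties into small sets, that of the dealer and three
others of which one may be empty. -/
theorem false_of_partition {t : ℕ} {ε : ℝ} (hε : 0 < ε) (hP : P.IsAVSS t (1 / 2 + ε))
    {A B C D : Finset (Fin n)} (hA : A.card ≤ t) (hB : B.card ≤ t) (hC : C.card ≤ t)
    (hD : D.card ≤ t) (hdD : P.dealer ∈ D) (hAB : Disjoint A B) (hAC : Disjoint A C)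
    (hBC : Disjoint B C) (hDc : D = (A ∪ B ∪ C)ᶜ) {a c : Fin n} (ha : a ∈ A) (hc : c ∈ C)
    {s s' : F} (hs : s ≠ s') : False := by
  classical
  have hmem : ∀ j, j ∉ D ↔ j ∈ A ∨ j ∈ B ∨ j ∈ C := by
    intro j; subst hDc; simp only [Finset.mem_compl, Finset.mem_union, not_not, or_assoc]
  have hdA : P.dealer ∉ A := fun h => (hmem _).2 (.inl h) hdD
  have hdB : P.dealer ∉ B := fun h => (hmem _).2 (.inr (.inl h)) hdD
  have hdC : P.dealer ∉ C := fun h => (hmem _).2 (.inr (.inr h)) hdD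
  have haD : a ∉ D := (hmem a).2 (.inl ha)
  have hcD : c ∉ D := (hmem c).2 (.inr (.inr hc))
  have hAB' : ∀ j ∈ A, j ∉ B := fun j h => Finset.disjoint_left.1 hAB h
  have hAC' : ∀ j ∈ A, j ∉ C := fun j h => Finset.disjoint_left.1 hAC h
  have hBC' : ∀ j ∈ B, j ∉ C := fun j h => Finset.disjoint_left.1 hBC h
  have hBA' : ∀ j ∈ B, j ∉ A := fun j h h' => hAB' j h' h
  have hCB' : ∀ j ∈ C, j ∉ B := fun j h h' => hBC' j h' h
  obtain ⟨sched₁, h₁⟩ := exists_covers ⟨_, startS_mem_shareMovesOff hdC⟩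
  obtain ⟨sched₂, h₂⟩ := exists_covers ⟨_, (startS_mem_shareMovesOff haD).1⟩
  obtain ⟨sched₃, h₃⟩ := exists_covers
    ⟨_, (startS_mem_shareMovesOff (Finset.notMem_empty P.dealer)).1⟩
  obtain ⟨K, hK⟩ := exists_share_time (half_pos hε) hP hC hdC h₁ (hAC' a ha) s
  have htarget : ∀ k, (sched₁ k).target ∉ C := fun k => (h₁.mem k).1.1
  -- The conversation is recorded at every time, not only at the end: the faulty dealer's set must
  -- reproduce the hybrid move by move.
  let T : List (World P) → List (Fin n → Fin n → List P.Msg × Finset ℕ) := List.map (cross A B)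
  let last : List (World P) → World P := fun h => h.getLastD (World.init P)
  let R : F → List (Sim P) → PMF (World P) := fun s₂ S =>
    (condLaw (hist P s₂ sched₁ K) T (S.map fun v => cross A B v.world)).map last
  -- The conversation with `A` is part of what `B` sees.
  have hT : (hist P s sched₁ K).map T = (hist P s' sched₁ K).map T := by
    have h := congrArg (PMF.map fun S : List (Sim P) => S.map fun v => cross A B v.world)
      (hist_map_sim_eq hP hB hdB (fun k => (h₁.mem k).2) s s' K)
    rw [PMF.map_comp, PMF.map_comp] at h
    simp only [Function.comp_def, map_cross_sim (.inr rfl : B = A ∨ B = B)] at h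
    exact h
  let ν := (hist P s sched₁ K).bind fun h =>
    (condLaw (hist P s' sched₁ K) T (T h)).map fun h' => (h, h')
  have hν : ν = (hist P s' sched₁ K).bind fun h' =>
      (condLaw (hist P s sched₁ K) T (T h')).map fun h => (h, h') := bind_condLaw_comm hT
  have hνs : ∀ p ∈ ν.support, p.1 ∈ (hist P s sched₁ K).support ∧
      p.2 ∈ (hist P s' sched₁ K).support ∧ T p.2 = T p.1 := by
    intro p hp
    simp only [ν, PMF.mem_support_bind_iff, PMF.support_map, Set.mem_image] at hp
    obtain ⟨h, hh, h', hh', rfl⟩ := hp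
    have hb : T h ∈ ((hist P s' sched₁ K).map T).support := by
      rw [← hT, PMF.support_map]
      exact ⟨h, hh, rfl⟩
    exact ⟨hh, mem_support_condLaw hb hh'⟩
  -- `B` lives in the execution with `s'`, everybody else in the one with `s`; for `C` the choice is
  -- immaterial.
  let U : List (World P) × List (World P) → ℕ → Fin n → World P := fun p τ j =>
    if j ∈ B then path p.2 τ else path p.1 τ
  let start := ν.map fun p => assemble D (U p K)
  have hcross : ∀ p ∈ ν.support, ∀ τ, cross A B (path p.1 τ) = cross A B (path p.2 τ) :=
    fun p hp τ => path_of_map_eq _ (hνs p hp).2.2.symm τ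
  -- First reading: `B` rewrites its memory. For deliveries from `B` to `A`, `glue` follows the
  -- sender and `assemble` the recipient; the two agree because the conversations coincide.
  have hg₁ : ∀ p ∈ ν.support, (glue B (last p.1) (last p.2)).mask D = assemble D (U p K) := by
    intro p hp
    obtain ⟨hp1, hp2, -⟩ := hνs p hp
    simp only [last]
    rw [← path_last hp1, ← path_last hp2]
    refine World.ext' (fun j => ?_) (fun i j => ?_) (fun i j => ?_)
    · by_cases h : j ∈ B <;> simp [World.mask, assemble, glue, U, h]
    · by_cases h : i ∈ B <;> simp [World.mask, assemble, glue, U, h]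
    · by_cases hij : i ∈ D ∨ j ∈ D
      · simp [World.mask, assemble, hij]
      · simp only [World.mask, assemble, if_neg hij, glue, U]
        by_cases hjB : j ∈ B
        · simp [hjB]
        · by_cases hiB : i ∈ B
          · simp only [hiB, hjB, true_or, if_true, if_false]
            rcases (hmem j).1 fun h => hij (.inr h) with hj | hj | hj
            · rw [(sent_eq_of_cross (hcross p hp K) (.inr ⟨hiB, hj⟩)).2]
            · exact absurd hj hjB
            · rw [(path_untouched htarget hp1 hj le_rfl).2.2,
                (path_untouched htarget hp2 hj le_rfl).2.2]
          · simp [hiB, hjB]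
  -- Second reading: `A` rewrites its memory inside the execution with `s'`.
  have hg₂ : ∀ p ∈ ν.support, (glue A (last p.2) (last p.1)).mask D = assemble D (U p K) := by
    intro p hp
    obtain ⟨hp1, hp2, -⟩ := hνs p hp
    simp only [last]
    rw [← path_last hp1, ← path_last hp2]
    refine World.ext' (fun j => ?_) (fun i j => ?_) (fun i j => ?_)
    · by_cases hjD : j ∈ D
      · simp [World.mask, assemble, hjD]
      · simp only [World.mask, assemble, if_neg hjD, glue, U]
        rcases (hmem j).1 hjD with hj | hj | hj
        · simp [hj, hAB' j hj]
        · simp [hj, hBA' j hj]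
        · rw [if_neg fun h => hAC' j h hj, if_neg fun h => hBC' j h hj,
            (path_untouched htarget hp1 hj le_rfl).1, (path_untouched htarget hp2 hj le_rfl).1]
    · by_cases hiD : i ∈ D
      · simp [World.mask, assemble, hiD]
      · simp only [World.mask, assemble, if_neg hiD, glue, U]
        rcases (hmem i).1 hiD with hj | hj | hj
        · simp [hj, hAB' i hj]
        · simp [hj, hBA' i hj]
        · rw [if_neg fun h => hAC' i h hj, if_neg fun h => hBC' i h hj,
            (path_untouched htarget hp1 hj le_rfl).2.1, (path_untouched htarget hp2 hj le_rfl).2.1]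
    · by_cases hij : i ∈ D ∨ j ∈ D
      · simp [World.mask, assemble, hij]
      · simp only [World.mask, assemble, if_neg hij, glue, U]
        rcases (hmem j).1 fun h => hij (.inr h) with hj | hj | hj
        · simp [hj, hAB' j hj]
        · have hjA : j ∉ A := fun h => hAB' j h hj
          by_cases hi : i ∈ A
          · simp only [hi, hj, true_or, if_true]
            rw [(sent_eq_of_cross (hcross p hp K) (.inl ⟨hi, hj⟩)).2]
          · simp [hi, hj, hjA]
        · rw [if_neg fun h => hBC' j h hj, (path_untouched htarget hp1 hj le_rfl).2.2,
            (path_untouched htarget hp2 hj le_rfl).2.2, ite_self]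
  refine not_isAVSS_of_common_law hε hP (sched₂ := sched₂) (start := start) (a := a) (c := c)
    (s := s) (s' := s') (s₁ := s) hs ?_ ?_ ?_
  · intro w hw hwa
    simp only [start, PMF.support_map, Set.mem_image] at hw
    obtain ⟨p, hp, rfl⟩ := hw
    obtain ⟨hp1, hp2, -⟩ := hνs p hp
    -- Third reading: `D` is faulty and shows each party the execution of its own source.
    refine chain_terminates hP hdD hD (U := U p) (sched := sched₁)
      (sec := fun j => if j ∈ B then s' else s) ?_ ?_ ?_ h₂ haD ?_ hcD s
    · intro j
      simp [U, path_zero]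
    · intro τ hτ j _
      by_cases hj : j ∈ B
      · simpa [U, hj] using path_step hp2 hτ
      · simpa [U, hj] using path_step hp1 hτ
    · intro τ hτ hj i hi
      have hx := hcross p hp τ
      have hjC := htarget τ
      have hiC : i ∈ C → ∀ j, (path p.2 τ).sent i j = (path p.1 τ).sent i j := fun h j => by
        rw [(path_untouched htarget hp1 h hτ.le).2.1, (path_untouched htarget hp2 h hτ.le).2.1]
      generalize (sched₁ τ).target = j at hj hjC
      simp only [U]
      rcases (hmem j).1 hj with hjA | hjB | hjC'
      · rcases (hmem i).1 hi with hiA | hiB | hiC'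
        · simp [hAB' j hjA, hAB' i hiA]
        · simpa [hAB' j hjA, hiB] using (sent_eq_of_cross hx (.inr ⟨hiB, hjA⟩)).1.symm
        · simp [hAB' j hjA, hCB' i hiC']
      · rcases (hmem i).1 hi with hiA | hiB | hiC'
        · simpa [hjB, hAB' i hiA] using (sent_eq_of_cross hx (.inl ⟨hiA, hjB⟩)).1
        · simp [hjB, hiB]
        · simpa [hjB, hCB' i hiC'] using (hiC hiC' j).symm
      · exact absurd hjC' hjC
    · obtain ⟨l, hl, hls⟩ := hwa
      simp only [assemble, if_neg haD] at hl
      exact ⟨l, hl, hls⟩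
  -- The data of `a` come from the execution with `s`, for which `K` was chosen.
  · refine lt_of_le_of_lt ?_ hK
    simp only [start, ← pmf_map_congr hg₁, ν]
    rw [PMF.map_bind]
    refine pmf_bind_compl_le _ _ fun h hh w hw => ?_
    simp only [PMF.map_comp, PMF.support_map, Set.mem_image] at hw
    obtain ⟨h', -, rfl⟩ := hw
    obtain ⟨l, hl, hls⟩ := hh
    exact ⟨l, by simpa [World.mask, glue, haD, hAB' a ha, last] using hl, hls⟩
  · intro s₂ hs₂ M hM
    rcases hs₂ with rfl | rfl
    · refine ⟨simAdv B s₂ K M sched₁ sched₂ sched₃ (R s'), K + M, hB, simAdv_fair h₃, hdB,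
        fun h => hBC' c h hc, ?_⟩
      rw [simAdv_loc hdB hdD h₂.mem (fun h => hBC' c h hc) hcD hM s₂ s₂]
      congr 1
      simp only [start, ← pmf_map_congr hg₁, ν]
      rw [PMF.map_bind]
      congr 1
      funext h
      simp only [R, map_cross_sim (.inr rfl : B = A ∨ B = B), PMF.map_comp]
      rfl
    · refine ⟨simAdv A s₂ K M sched₁ sched₂ sched₃ (R s), K + M, hA, simAdv_fair h₃, hdA,
        fun h => hAC' c h hc, ?_⟩
      rw [simAdv_loc hdA hdD h₂.mem (fun h => hAC' c h hc) hcD hM s₂ s]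
      congr 1
      simp only [start, ← pmf_map_congr hg₂]
      -- The same coupling, with the history for `s'` drawn first.
      rw [hν, PMF.map_bind]
      congr 1
      funext h
      simp only [R, map_cross_sim (.inl rfl : A = A ∨ A = B), PMF.map_comp]
      rfl

/-- The lower bound, when the parties other than those of the dealer's set form a small set. -/
theorem false_of_two_sets {t : ℕ} {ε : ℝ} (hε : 0 < ε) (hP : P.IsAVSS t (1 / 2 + ε))
    {D : Finset (Fin n)} (hD : D.card ≤ t) (hDc : Dᶜ.card ≤ t) (hdD : P.dealer ∈ D)
    {a : Fin n} (ha : a ∉ D) {s s' : F} (hs : s ≠ s') : False := by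
  have hd : P.dealer ∉ (∅ : Finset (Fin n)) := Finset.notMem_empty _
  have ht : (∅ : Finset (Fin n)).card ≤ t := by simp
  obtain ⟨sched₁, h₁⟩ := exists_covers ⟨_, startS_mem_shareMovesOff hd⟩
  obtain ⟨sched₂, h₂⟩ := exists_covers ⟨_, (startS_mem_shareMovesOff ha).1⟩
  obtain ⟨sched₃, h₃⟩ := exists_covers ⟨_, (startS_mem_shareMovesOff hd).1⟩
  obtain ⟨K, hK⟩ := exists_share_time (half_pos hε) hP ht hd h₁ (Finset.notMem_empty a) s
  let start : F → PMF (World P) := fun s₂ =>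
    (hist P s₂ sched₁ K).map fun h => (h.getLastD (World.init P)).mask D
  -- The complement of `D` is small enough for secrecy and sees everything that survives the
  -- deletion of `D`.
  have hstart : start s = start s' := by
    have hmask : ∀ u : World P, u.mask D = (u.sim Dᶜ).world.mask D := by
      intro u
      refine World.ext' (fun j => ?_) (fun i j => ?_) (fun i j => ?_)
      · by_cases h : j ∈ D <;> simp [World.mask, World.sim, h]
      · by_cases h : i ∈ D <;> simp [World.mask, World.sim, h]
      · by_cases h : i ∈ D <;> simp [World.mask, World.sim, h]
    have h := congrArg (PMF.map fun S : List (Sim P) =>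
        (S.getLastD ((World.init P).sim Dᶜ)).world.mask D)
      (hist_map_sim_eq hP hDc (by simpa using hdD) (fun k => (h₁.mem k).2) s s' K)
    rw [PMF.map_comp, PMF.map_comp] at h
    simp only [Function.comp_def, getLastD_map, ← hmask] at h
    exact h
  refine not_isAVSS_of_common_law hε hP (sched₂ := sched₂) (start := start s) (a := a) (c := a)
    (s := s) (s' := s') (s₁ := s) hs ?_ ?_ ?_
  · intro w hw hwa
    simp only [start, PMF.support_map, Set.mem_image] at hw
    obtain ⟨h, hh, rfl⟩ := hw
    rw [← path_last hh] at hwa ⊢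
    refine chain_terminates hP hdD hD (U := fun τ _ => path h τ) (sched := sched₁)
      (sec := fun _ => s) (fun _ => path_zero h) (fun τ hτ _ _ => path_step hh hτ)
      (fun _ _ _ _ _ => rfl) h₂ ha ?_ ha s
    obtain ⟨l, hl, hls⟩ := hwa
    exact ⟨l, by simpa [World.mask, ha] using hl, hls⟩
  · refine lt_of_le_of_lt ?_ hK
    refine pmf_bind_compl_le _ _ fun h hh w hw => ?_
    rw [Function.comp_apply, PMF.mem_support_pure_iff] at hw
    subst hw
    obtain ⟨l, hl, hls⟩ := hh
    exact ⟨l, by simpa [World.mask, ha] using hl, hls⟩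
  · intro s₂ hs₂ M hM
    -- Nobody is faulty; the adversary only holds back the messages of `D` after step `K`.
    refine ⟨simAdv ∅ s₂ K M sched₁ sched₂ sched₃ fun _ => PMF.pure (World.init P), K + M, ht,
      simAdv_fair h₃, hd, Finset.notMem_empty a, ?_⟩
    rw [simAdv_loc hd hdD h₂.mem (Finset.notMem_empty a) ha hM s₂ s]
    congr 1
    have : start s = start s₂ := by
      rcases hs₂ with rfl | rfl
      · rfl
      · exact hstart
    rw [this]
    simp only [start, PMF.pure_map]
    refine pmf_bind_congr fun h _ => ?_
    simp [glue]

/-! ### Choice of the partition and conclusion -/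

theorem exists_partition {t : ℕ} (hn : 3 ≤ n) (hnt : n ≤ 4 * t) (d : Fin n) :
    ∃ A B C D : Finset (Fin n), A.card ≤ t ∧ B.card ≤ t ∧ C.card ≤ t ∧ D.card ≤ t ∧ d ∈ D ∧
      Disjoint A B ∧ Disjoint A C ∧ Disjoint B C ∧ D = (A ∪ B ∪ C)ᶜ ∧ A.Nonempty ∧
      C.Nonempty := by
  have h0 : (Finset.univ.erase d).card = n - 1 := by simp
  -- The bound `n - 2` spares the dealer and one party for `A`. Then `A` and `B` are filled
  -- greedily, and at most `t` parties, among them `d`, remain for `D`.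
  obtain ⟨C, hCs, hC⟩ := Finset.exists_subset_card_eq
    (s := Finset.univ.erase d) (n := min t (n - 2)) (by omega)
  have h1 : (Finset.univ.erase d \ C).card = n - 1 - min t (n - 2) := by
    rw [Finset.card_sdiff_of_subset hCs, h0, hC]
  obtain ⟨A, hAs, hA⟩ := Finset.exists_subset_card_eq
    (s := Finset.univ.erase d \ C) (n := min t (n - 1 - min t (n - 2))) (by omega)
  have h2 : ((Finset.univ.erase d \ C) \ A).card =
      n - 1 - min t (n - 2) - min t (n - 1 - min t (n - 2)) := by
    rw [Finset.card_sdiff_of_subset hAs, h1, hA]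
  obtain ⟨B, hBs, hB⟩ := Finset.exists_subset_card_eq (s := (Finset.univ.erase d \ C) \ A)
    (n := min t (n - 1 - min t (n - 2) - min t (n - 1 - min t (n - 2)))) (by omega)
  have hAC : Disjoint A C := Finset.disjoint_left.2 fun x hx => (Finset.mem_sdiff.1 (hAs hx)).2
  have hAB : Disjoint A B := Finset.disjoint_right.2 fun x hx => (Finset.mem_sdiff.1 (hBs hx)).2
  have hBC : Disjoint B C := Finset.disjoint_left.2 fun x hx =>
    (Finset.mem_sdiff.1 (Finset.mem_sdiff.1 (hBs hx)).1).2
  refine ⟨A, B, C, (A ∪ B ∪ C)ᶜ, by omega, by omega, by omega, ?_, ?_, hAB, hAC, hBC, rfl,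
    Finset.card_pos.1 (by omega), Finset.card_pos.1 (by omega)⟩
  · rw [Finset.card_compl, Finset.card_union_of_disjoint
      (Finset.disjoint_union_left.2 ⟨hAC, hBC⟩), Finset.card_union_of_disjoint hAB,
      Fintype.card_fin]
    omega
  · simp only [Finset.mem_compl, Finset.mem_union, not_or]
    refine ⟨⟨fun h => ?_, fun h => ?_⟩, fun h => ?_⟩
    · exact Finset.notMem_erase d _ (Finset.mem_sdiff.1 (hAs h)).1
    · exact Finset.notMem_erase d _ (Finset.mem_sdiff.1 (Finset.mem_sdiff.1 (hBs h)).1).1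
    · exact Finset.notMem_erase d _ (hCs h)

end AVSS

theorem theorem1 {F : Type*} [Field F] [Finite F] (n t : ℕ) (hn : 2 ≤ n) (hnt : n ≤ 4 * t)
    (ε : ℝ) (hε : 0 < ε) (P : AVSS.Protocol n F) :
    ¬ P.IsAVSS t (1 / 2 + ε) := by
  intro hP
  rcases hn.eq_or_lt with rfl | hn
  -- Two parties are too few for nonempty `A`, `C` and `D`; here `t ≥ 1`, so each singleton is
  -- small.
  · have hc : ({P.dealer} : Finset (Fin 2))ᶜ.card = 1 := by simp [Finset.card_compl]
    obtain ⟨a, ha⟩ := Finset.card_pos.1 (hc.symm ▸ one_pos)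
    exact AVSS.false_of_two_sets hε hP (by simp; omega) (by omega)
      (Finset.mem_singleton_self P.dealer) (Finset.mem_compl.1 ha) (zero_ne_one (α := F))
  · obtain ⟨A, B, C, D, hA, hB, hC, hD, hd, hAB, hAC, hBC, hDc, ⟨a, ha⟩, ⟨c, hc⟩⟩ :=
      AVSS.exists_partition (n := n) hn hnt P.dealer
    exact AVSS.false_of_partition hε hP hA hB hC hD hd hAB hAC hBC hDc ha hc (zero_ne_one (α := F))
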